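/- **Setting.** Terms are built over a signature of function symbols and a set of variables; a substitution moves finitely many variables. Let $\succ$ be a Knuth--Bendix order (for a total precedence $\gg$ and a weight function $w$ into $\mathbb N$), a lexicographic path order (for a total precedence $\gg$), or another simplification ordering. Here $|t|$ is the weight of $t$, the linear expression $\sum_f |t|_f w(f)+\sum_x |t|_x\,x$, and $\sigma(\alpha_0+\sum\alpha_i x_i)=\alpha_0+\sum\alpha_i|x_i\sigma|$; $\sigma$ is grounding for $e$ if $\sigma(e)$ is a constant and every $|x\sigma|$ that is a constant is at least the smallest weight of a constant symbol; $e>0$ (resp. $e\gtrsim0$) means $\sigma(e)>0$ (resp. $\ge0$) for all $\sigma$ grounding for $e$. The KBO is defined by: $s\succ t$ iff (K1) $|s|-|t|>0$; or $|s|-|t|\gtrsim0$, $s=f(\bar s)$, $t=g(\bar t)$ and (K2) $f\gg g$, or (K3) $f=g$ and for some $i$, $s_j=t_j$ for $j<i$ and $s_i\succ t_i$. The LPO is the usual one. **TODs.** A term ordering diagram (TOD) is a finite acyclic directed multigraph with one root (one unlabelled outgoing edge), from which every node is reachable; one exit node, without outgoing edges and reachable from every node; and further nodes of three kinds: term comparison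 nodes $s\,?\,t$ with outgoing edges labelled $>,=,\ngeq$; positivity check nodes $e\,?\,0$ ($e$ a linear expression; only for KBO) with outgoing edges labelled $>,\ge,\ngeq$; and success nodes, labelled by an equality $l\simeq r$, with one unlabelled outgoing edge. The first two kinds are the evaluation nodes. Put $\sigma(s\,?\,t)={>}$ if $s\sigma\succ t\sigma$, ${=}$ if $s\sigma=t\sigma$, and $\ngeq$ otherwise; $\sigma(e\,?\,0)={>}$ if $\sigma(e)>0$, otherwise $\ge$ if $\sigma(e)\gtrsim0$, and otherwise $\ngeq$. A $\sigma$-path is a path that leaves each evaluation node labelled $c$ on it along the edge labelled $\sigma(c)$. The traversal for $\sigma$ is the $\sigma$-path from the root to the exit; the success set of $\sigma$ is the set of labels of the success nodes on it. Two TODs are equivalent if every $\sigma$ has the same success set in both. An evaluation node $n$ labelled $c$ forces $\ell$ if $\sigma(c)=\ell$ for every $\sigma$ whose traversal contains $n$. **Transformations.** After (a) and (c), non-root nodes without incoming edges are removed repeatedly. (a) *Redundant node removal*: if $n$ forces $\ell$, an edge into $n$ is redirected to the target of the $\ell$-edge of $n$. (b) *Node replication*: if the non-exit node $n$ has several incoming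 edges, one of them is redirected to a new node that is an exact copy of $n$ with the same outgoing edges. (c) *KBO/LPO transformations* of a node $n$ labelled $f(s_1,\dots,s_k)\,?\,g(t_1,\dots,t_m)$ whose $>,=,\ngeq$ edges lead to $n_1,n_2,n_3$. Write $[c;a,b,d]$ for a node labelled $c$ whose three edges lead, in order, to $a,b,d$; all other nodes named are new. Below $s=f(\bar s)$, $t=g(\bar t)$. KBO: $n$ becomes $[|s|-|t|\,?\,0;\,n_1,x,n_3]$ with $x=n_1$ if $f\gg g$; $x=n_3$ if $g\gg f$; and, if $f=g$, $x=p_1$ with $p_i=[s_i\,?\,t_i;\,n_1,p_{i+1},n_3]$ for $1\le i\le k$ and $p_{k+1}=n_2$. LPO: $n$ is replaced by $p_1$, where: if $f\gg g$, $p_i=[s\,?\,t_i;\,p_{i+1},n_3,n_3]$ for $1\le i\le m$, $p_{m+1}=n_1$; if $g\gg f$, $p_i=[s_i\,?\,t;\,n_1,n_1,p_{i+1}]$ for $1\le i\le k$, $p_{k+1}=n_3$; if $f=g$, $p_i=[s_i\,?\,t_i;\,a_{i+1},p_{i+1},b_{i+1}]$ for $1\le i\le k$, $p_{k+1}=n_2$,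 and $a_i=[s\,?\,t_i;\,a_{i+1},n_3,n_3]$, $b_i=[s_i\,?\,t;\,n_1,n_1,b_{i+1}]$ for $2\le i\le k$, $a_{k+1}=n_1$, $b_{k+1}=n_3$. **Retrieval.** A forcing function is a partial function $F$ from paths of TODs to edge labels such that for every $\sigma$ and every $\sigma$-path from the root consisting of a path $\pi$ and one further edge, if $F(\pi)=\ell$ then that edge is labelled $\ell$. An index is a TOD in which some nodes are marked visited. A retrieval for $\sigma$ starts at the successor of the root and repeats the following steps, $n$ being the current node and $\pi$ the path followed from the root to $n$. 1. If $n$ is the exit node, stop. 2. If $n$ is a success node, one may stop (when only one candidate is wanted); if $n$ is a visited success node, one may go to its successor. 3. If $n$ is an unvisited evaluation or success node: if $n$ has more than one incoming edge, replicate it, redirecting the edge just followed to the copy, which becomes the current node. Once there is only one incoming edge: (3a) if $n$ is an evaluation node and $F(\pi)=\ell$, redirect this edge to the target of the $\ell$-edge of $n$ (which becomes the current node) and remove nodes without incoming edges as above; (3b) if a KBO transformation (for $\succ$ a KBO) or an LPO transformation (for $\succ$ an LPO) applies to $n$, apply it, the node replacing $n$ becoming the current node; (3c) otherwise mark $n$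 visited. 4. If $n$ is a visited evaluation node labelled $c$, follow its edge labelled $\sigma(c)$. **Lemma (Correctness).** Let $F$ be a forcing function, and let an index be given that arises from a TOD without visited nodes by a finite sequence of retrievals and insertions (an insertion of $l\simeq r$ redirects all edges to the exit node to a new node $l\,?\,r$ whose $>$ edge leads to a new success node $l\simeq r$ and whose other edges, as well as the edge of that success node, lead to the exit node). Let $\mathcal D$ be its TOD and $\sigma$ a substitution. Then the diagram $\mathcal D'$ resulting from a retrieval for $\sigma$ is a TOD equivalent to $\mathcal D$. Moreover, at every point of the retrieval the current diagram is a TOD equivalent to $\mathcal D$; every visited node has exactly one path from the root; every step (3a) is a genuine redundant node removal, i.e. $n$ forces $\ell$; and every step leaves the TOD unchanged or is an instance of one of the transformations (a)--(c). -/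

import Mathlib

open FirstOrder.Language

universe u v w

namespace TOD

/-! ## Terms, substitutions, linear expressions

Terms are Mathlib's first-order terms `L.Term V` over the function symbols of `L`
and the variables `V`; the relation symbols of `L` play no role. -/

section Terms

variable {L : FirstOrder.Language.{u, v}} {V : Type w}

/-- The function symbols of the signature. -/
abbrev Symb (L : FirstOrder.Language.{u, v}) : Type u := Σ n, L.Functions n

/-- A substitution: a map from variables to terms moving only finitely many variables. -/
structure Subst (L : FirstOrder.Language.{u, v}) (V : Type w) where
  toFun : V → L.Term V
  finite_moved : {x | toFun x ≠ Term.var x}.Finite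

/-- `σ.app t` is the term `tσ`. -/
def Subst.app (σ : Subst L V) (t : L.Term V) : L.Term V := t.subst σ.toFun

/-- `ImmediateSubterm t s`: `t` is an argument of `s`. -/
inductive ImmediateSubterm : L.Term V → L.Term V → Prop
  | mk {k : ℕ} (f : L.Functions k) (ss : Fin k → L.Term V) (i : Fin k) :
      ImmediateSubterm (ss i) (Term.func f ss)

/-- `ProperSubterm t s`: `t` is a proper subterm of `s`. -/
def ProperSubterm : L.Term V → L.Term V → Prop := Relation.TransGen ImmediateSubterm

/-- Simplification orderings; `gt s t` is `s ≻ t`. -/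
structure IsSimplificationOrdering (gt : L.Term V → L.Term V → Prop) : Prop where
  irrefl : ∀ s, ¬ gt s s
  trans : ∀ s t u, gt s t → gt t u → gt s u
  wellFounded : WellFounded fun s t => gt t s
  stable : ∀ (σ : Subst L V) s t, gt s t → gt (σ.app s) (σ.app t)
  monotone : ∀ {k : ℕ} (f : L.Functions k) (ss : Fin k → L.Term V) (i : Fin k) s t, gt s t →
    gt (Term.func f (Function.update ss i s)) (Term.func f (Function.update ss i t))
  subterm : ∀ s t, ProperSubterm t s → gt s t

/-- Linear expressions `α₀ + ∑ αₓ · x` with integer coefficients: the constant part and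
the (finitely supported) coefficients. -/
abbrev LinExpr (V : Type w) : Type w := ℤ × (V →₀ ℤ)

/-- The weight `|t|` of a term: the sum of the weights of the occurrences of function symbols
plus the sum of the occurrences of variables. -/
noncomputable def weight (wt : Symb L → ℕ) : L.Term V → LinExpr V
  | .var x => (0, Finsupp.single x 1)
  | .func f ts => ((wt ⟨_, f⟩ : ℤ), 0) + ∑ i, weight wt (ts i)

/-- `σ(α₀ + ∑ αₓ · x) = α₀ + ∑ αₓ · |xσ|`. -/
noncomputable def Subst.appLin (wt : Symb L → ℕ) (σ : Subst L V) (e : LinExpr V) : LinExpr V :=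
  (e.1, 0) + e.2.sum fun x a => a • weight wt (σ.toFun x)

/-- The smallest weight of a constant. -/
noncomputable def minConstWeight (wt : Symb L → ℕ) : ℕ :=
  sInf {a | ∃ c : L.Functions 0, a = wt ⟨0, c⟩}

/-- `σ` is grounding for `e`. -/
def Grounding (wt : Symb L → ℕ) (σ : Subst L V) (e : LinExpr V) : Prop :=
  (σ.appLin wt e).2 = 0 ∧
    ∀ x, (weight wt (σ.toFun x)).2 = 0 →
      (minConstWeight wt : ℤ) ≤ (weight wt (σ.toFun x)).1

/-- `e > 0`: positive under every grounding substitution. -/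
def LinPos (wt : Symb L → ℕ) (e : LinExpr V) : Prop :=
  ∀ σ : Subst L V, Grounding wt σ e → 0 < (σ.appLin wt e).1

/-- `e ≳ 0`: nonnegative under every grounding substitution. -/
def LinNonneg (wt : Symb L → ℕ) (e : LinExpr V) : Prop :=
  ∀ σ : Subst L V, Grounding wt σ e → 0 ≤ (σ.appLin wt e).1

/-- The Knuth-Bendix order with precedence `prec` (`prec f g` is `f ≫ g`) and weights `wt`. -/
inductive KBO (prec : Symb L → Symb L → Prop) (wt : Symb L → ℕ) :
    L.Term V → L.Term V → Prop
  | weight_gt {s t : L.Term V} : LinPos wt (weight wt s - weight wt t) → KBO prec wt s t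
  | prec {k m : ℕ} {f : L.Functions k} {g : L.Functions m}
      {ss : Fin k → L.Term V} {ts : Fin m → L.Term V} :
      LinNonneg wt (weight wt (Term.func f ss) - weight wt (Term.func g ts)) →
      prec ⟨k, f⟩ ⟨m, g⟩ →
      KBO prec wt (Term.func f ss) (Term.func g ts)
  | lex {k : ℕ} {f : L.Functions k} {ss ts : Fin k → L.Term V} (i : Fin k) :
      LinNonneg wt (weight wt (Term.func f ss) - weight wt (Term.func f ts)) →
      KBO prec wt (ss i) (ts i) → (∀ j, j < i → ss j = ts j) →
      KBO prec wt (Term.func f ss) (Term.func f ts)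

/-- The lexicographic path order with precedence `prec`. -/
inductive LPO (prec : Symb L → Symb L → Prop) : L.Term V → L.Term V → Prop
  | lex {k : ℕ} {f : L.Functions k} {ss ts : Fin k → L.Term V} (i : Fin k) :
      (∀ j, j < i → ss j = ts j) → LPO prec (ss i) (ts i) →
      (∀ j, i < j → LPO prec (Term.func f ss) (ts j)) →
      LPO prec (Term.func f ss) (Term.func f ts)
  | prec {k m : ℕ} {f : L.Functions k} {g : L.Functions m}
      {ss : Fin k → L.Term V} {ts : Fin m → L.Term V} :
      prec ⟨k, f⟩ ⟨m, g⟩ → (∀ j, LPO prec (Term.func f ss) (ts j)) →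
      LPO prec (Term.func f ss) (Term.func g ts)
  | arg_gt {k : ℕ} {f : L.Functions k} {ss : Fin k → L.Term V} {t : L.Term V} (i : Fin k) :
      LPO prec (ss i) t → LPO prec (Term.func f ss) t
  | arg_eq {k : ℕ} {f : L.Functions k} {ss : Fin k → L.Term V} (i : Fin k) :
      LPO prec (Term.func f ss) (ss i)

/-- The term ordering used: a KBO, an LPO, or some other simplification ordering
(for which only the ordering-independent transformations are available).
A precedence is a (strict) total order on the function symbols. -/
inductive TermOrdering (L : FirstOrder.Language.{u, v}) (V : Type w) where
  | kbo (prec : Symb L → Symb L → Prop) (hprec : IsStrictTotalOrder (Symb L) prec)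
      (wt : Symb L → ℕ)
  | lpo (prec : Symb L → Symb L → Prop) (hprec : IsStrictTotalOrder (Symb L) prec)
  | other (gt : L.Term V → L.Term V → Prop) (hgt : IsSimplificationOrdering gt)

/-- The relation `≻`. -/
def TermOrdering.gt : TermOrdering L V → L.Term V → L.Term V → Prop
  | .kbo prec _ wt => KBO prec wt
  | .lpo prec _ => LPO prec
  | .other gt _ => gt

/-- The ordering is a KBO. -/
def TermOrdering.IsKBO : TermOrdering L V → Prop
  | .kbo _ _ _ => True
  | _ => False

end Terms

/-! ## Term ordering diagrams -/

/-- The edge labels `>`, `=`, `≥` and `≱`. -/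
inductive EdgeLabel
  | gt | eq | geq | ngeq
  deriving DecidableEq

/-- What a node carries: root, exit, a term comparison `s ? t`, a positivity check `e ? 0`,
or (success node) an equality `l ≃ r`. -/
inductive NodeLabel (L : FirstOrder.Language.{u, v}) (V : Type w)
  | root
  | exit
  | cmp (s t : L.Term V)
  | pos (e : LinExpr V)
  | success (l r : L.Term V)

section Diagrams

variable {L : FirstOrder.Language.{u, v}} {V : Type w}

open Classical in
/-- The value `σ(s ? t)`. -/
noncomputable def TermOrdering.evalCmp (ord : TermOrdering L V) (σ : Subst L V)
    (s t : L.Term V) : EdgeLabel :=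
  if ord.gt (σ.app s) (σ.app t) then .gt
  else if σ.app s = σ.app t then .eq
  else .ngeq

open Classical in
/-- The value `σ(e ? 0)`. Positivity checks only occur for KBO; the value for the
other orderings is irrelevant. -/
noncomputable def TermOrdering.evalPos (ord : TermOrdering L V) (σ : Subst L V)
    (e : LinExpr V) : EdgeLabel :=
  match ord with
  | .kbo _ _ wt =>
      if LinPos wt (σ.appLin wt e) then .gt
      else if LinNonneg wt (σ.appLin wt e) then .geq
      else .ngeq
  | _ => .ngeq

/-- The label of the edge along which `σ` leaves a node with the given label
(`none` at nodes that are not evaluation nodes: their outgoing edge is unlabelled). -/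
noncomputable def TermOrdering.eval (ord : TermOrdering L V) (σ : Subst L V) :
    NodeLabel L V → Option EdgeLabel
  | .cmp s t => some (ord.evalCmp σ s t)
  | .pos e => some (ord.evalPos σ e)
  | _ => none

/-- Evaluation nodes: term comparison nodes and positivity check nodes. -/
def NodeLabel.IsEval : NodeLabel L V → Prop
  | .cmp _ _ => True
  | .pos _ => True
  | _ => False

/-- Success nodes. -/
def NodeLabel.IsSuccess : NodeLabel L V → Prop
  | .success _ _ => True
  | _ => False

/-- The outgoing edges that a node with the given label has (`none`: an unlabelled edge). -/
def NodeLabel.out : NodeLabel L V → Set (Option EdgeLabel)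
  | .root => {none}
  | .exit => ∅
  | .cmp _ _ => {some .gt, some .eq, some .ngeq}
  | .pos _ => {some .gt, some .geq, some .ngeq}
  | .success _ _ => {none}

/-- A finite rooted labelled multigraph with node names in `ℕ`. The values of `label` outside of
`nodes`, and the values of `next` where there is no edge, are irrelevant. -/
structure Diagram (L : FirstOrder.Language.{u, v}) (V : Type w) where
  nodes : Finset ℕ
  root : ℕ
  exit : ℕ
  label : ℕ → NodeLabel L V
  next : ℕ → Option EdgeLabel → ℕ

namespace Diagram

/-- There is an edge from `m` to `n` with label `ℓ`. -/
def Edge (D : Diagram L V) (m : ℕ) (ℓ : Option EdgeLabel) (n : ℕ) : Prop :=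
  m ∈ D.nodes ∧ ℓ ∈ (D.label m).out ∧ D.next m ℓ = n

/-- There is an edge from `m` to `n`. -/
def Adj (D : Diagram L V) (m n : ℕ) : Prop := ∃ ℓ, D.Edge m ℓ n

/-- The incoming edges of `n`, as pairs of a source and an edge label. -/
def inEdges (D : Diagram L V) (n : ℕ) : Set (ℕ × Option EdgeLabel) :=
  {p | D.Edge p.1 p.2 n}

/-- Term ordering diagrams. -/
structure IsTOD (ord : TermOrdering L V) (D : Diagram L V) : Prop where
  root_mem : D.root ∈ D.nodes
  exit_mem : D.exit ∈ D.nodes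
  label_root : ∀ n ∈ D.nodes, (D.label n = .root ↔ n = D.root)
  label_exit : ∀ n ∈ D.nodes, (D.label n = .exit ↔ n = D.exit)
  target_mem : ∀ m ℓ n, D.Edge m ℓ n → n ∈ D.nodes
  acyclic : ∀ n, ¬ Relation.TransGen D.Adj n n
  reachable_root : ∀ n ∈ D.nodes, Relation.ReflTransGen D.Adj D.root n
  reaches_exit : ∀ n ∈ D.nodes, Relation.ReflTransGen D.Adj n D.exit
  pos_kbo : ∀ n ∈ D.nodes, ∀ e, D.label n = .pos e → ord.IsKBO

/-- A path is given by its sequence of edges, each edge by its source and its label: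
`D.IsPath a π b` says that `π` is a path from `a` to `b`. -/
inductive IsPath (D : Diagram L V) : ℕ → List (ℕ × Option EdgeLabel) → ℕ → Prop
  | nil {a : ℕ} : a ∈ D.nodes → IsPath D a [] a
  | cons {a c b : ℕ} {ℓ : Option EdgeLabel} {π : List (ℕ × Option EdgeLabel)} :
      D.Edge a ℓ c → IsPath D c π b → IsPath D a ((a, ℓ) :: π) b

/-- Every edge of `π` that leaves an evaluation node is the one chosen by `σ`. -/
def IsSubstPath (ord : TermOrdering L V) (D : Diagram L V) (σ : Subst L V)
    (π : List (ℕ × Option EdgeLabel)) : Prop :=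
  ∀ p ∈ π, (D.label p.1).IsEval → p.2 = ord.eval σ (D.label p.1)

/-- `π` is the traversal of `D` for `σ`. (In a TOD there is exactly one such `π`.) -/
def IsTraversal (ord : TermOrdering L V) (D : Diagram L V) (σ : Subst L V)
    (π : List (ℕ × Option EdgeLabel)) : Prop :=
  D.IsPath D.root π D.exit ∧ D.IsSubstPath ord σ π

/-- The success set of `σ` in `D`: the labels of the success nodes on the traversal. -/
def successSet (ord : TermOrdering L V) (D : Diagram L V) (σ : Subst L V) :
    Set (L.Term V × L.Term V) :=
  {q | ∃ π, D.IsTraversal ord σ π ∧ ∃ p ∈ π, D.label p.1 = .success q.1 q.2}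

/-- Equivalence of TODs. -/
def Equivalent (ord : TermOrdering L V) (D₁ D₂ : Diagram L V) : Prop :=
  ∀ σ : Subst L V, D₁.successSet ord σ = D₂.successSet ord σ

/-- The evaluation node `n` forces the edge label `ℓ`. -/
def Forces (ord : TermOrdering L V) (D : Diagram L V) (n : ℕ) (ℓ : EdgeLabel) : Prop :=
  (D.label n).IsEval ∧
    ∀ (σ : Subst L V) (π : List (ℕ × Option EdgeLabel)), D.IsTraversal ord σ π →
      (∃ p ∈ π, p.1 = n) → ord.eval σ (D.label n) = some ℓ

/-! ## Transformations -/

/-- Remove a node other than the root that has no incoming edge. -/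
def RemoveOrphan (D D' : Diagram L V) : Prop :=
  ∃ n ∈ D.nodes, n ≠ D.root ∧ D.inEdges n = ∅ ∧ D' = { D with nodes := D.nodes.erase n }

/-- Repeatedly remove nodes without incoming edges (other than the root) until there are none. -/
def Cleanup (D D' : Diagram L V) : Prop :=
  Relation.ReflTransGen RemoveOrphan D D' ∧
    ∀ n ∈ D'.nodes, n ≠ D'.root → (D'.inEdges n).Nonempty

/-- Let the edge of `m` labelled `ℓ` point to `n`. -/
def redirect (D : Diagram L V) (m : ℕ) (ℓ : Option EdgeLabel) (n : ℕ) : Diagram L V :=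
  { D with next := fun a b => if a = m ∧ b = ℓ then n else D.next a b }

/-- Let all edges to `n` point to `n'` instead. -/
def replaceNode (D : Diagram L V) (n n' : ℕ) : Diagram L V :=
  { D with next := fun a b => if D.next a b = n then n' else D.next a b }

/-- Bypass: the edge from `m` to `n` labelled `ℓ'` is redirected to the target of the edge of the
evaluation node `n` labelled `ℓ`, namely `n₂`; then nodes without incoming edges are removed. -/
def Bypass (D : Diagram L V) (m : ℕ) (ℓ' : Option EdgeLabel) (n : ℕ) (ℓ : EdgeLabel) (n₂ : ℕ)
    (D' : Diagram L V) : Prop :=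
  D.Edge m ℓ' n ∧ (D.label n).IsEval ∧ D.Edge n (some ℓ) n₂ ∧ Cleanup (D.redirect m ℓ' n₂) D'

/-- Redundant node removal: a bypass of a node along a label that this node forces. -/
def RedundantNodeRemoval (ord : TermOrdering L V) (D : Diagram L V) (m : ℕ)
    (ℓ' : Option EdgeLabel) (n : ℕ) (ℓ : EdgeLabel) (n₂ : ℕ) (D' : Diagram L V) : Prop :=
  D.Forces ord n ℓ ∧ D.Bypass m ℓ' n ℓ n₂ D'

/-- Node replication: the non-exit node `n` has several incoming edges; the one from `m` with label
`ℓ` is redirected to an exact copy `n₂` of `n`, a new node with the same label and the same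
outgoing edges. -/
def NodeReplication (D : Diagram L V) (m : ℕ) (ℓ : Option EdgeLabel) (n n₂ : ℕ)
    (D' : Diagram L V) : Prop :=
  D.Edge m ℓ n ∧ n ≠ D.exit ∧ (D.inEdges n).Nontrivial ∧ n₂ ∉ D.nodes ∧
    D' = { D with
      nodes := insert n₂ D.nodes
      label := fun a => if a = n₂ then D.label n else D.label a
      next := fun a b =>
        if a = m ∧ b = ℓ then n₂ else if a = n₂ then D.next n b else D.next a b }

/-- `n` is a term comparison node `s ? t` with `>`, `=`, `≱` edges to `a`, `b`, `c`. -/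
def IsCmp (D : Diagram L V) (n : ℕ) (s t : L.Term V) (a b c : ℕ) : Prop :=
  n ∈ D.nodes ∧ D.label n = .cmp s t ∧
    D.next n (some .gt) = a ∧ D.next n (some .eq) = b ∧ D.next n (some .ngeq) = c

/-- `n` is a positivity check node `e ? 0` with `>`, `≥`, `≱` edges to `a`, `b`, `c`. -/
def IsPos (D : Diagram L V) (n : ℕ) (e : LinExpr V) (a b c : ℕ) : Prop :=
  n ∈ D.nodes ∧ D.label n = .pos e ∧
    D.next n (some .gt) = a ∧ D.next n (some .geq) = b ∧ D.next n (some .ngeq) = c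

/-- `D'` has the nodes of `D` and the pairwise distinct new nodes `ν i`, and agrees with `D`
at all nodes of `D` except `n`. -/
structure Extends {ι : Type} (D : Diagram L V) (n : ℕ) (ν : ι → ℕ) (D' : Diagram L V) : Prop where
  injective : Function.Injective ν
  fresh : ∀ i, ν i ∉ D.nodes
  root_eq : D'.root = D.root
  exit_eq : D'.exit = D.exit
  nodes_eq : ∀ m, m ∈ D'.nodes ↔ m ∈ D.nodes ∨ ∃ i, ν i = m
  label_eq : ∀ m ∈ D.nodes, m ≠ n → D'.label m = D.label m
  next_eq : ∀ m ∈ D.nodes, m ≠ n → D'.next m = D.next m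

/-- `ν j`, or `d` if `j` is beyond the end of the sequence `ν`. -/
def nodeAt {k : ℕ} (ν : Fin k → ℕ) (d : ℕ) (j : ℕ) : ℕ :=
  if h : j < k then ν ⟨j, h⟩ else d

/-- The KBO transformations of a node `n` labelled `f(s₁,…,s_k) ? g(t₁,…,t_m)`
with `>`, `=`, `≱` edges to `n₁`, `n₂`, `n₃` (before removal of nodes without incoming edges). -/
inductive KBOReplace (prec : Symb L → Symb L → Prop) (wt : Symb L → ℕ)
    (D : Diagram L V) (n : ℕ) (D' : Diagram L V) : Prop
  | greater {k m : ℕ} {f : L.Functions k} {g : L.Functions m}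
      {ss : Fin k → L.Term V} {ts : Fin m → L.Term V} {n₁ n₂ n₃ : ℕ} :
      D.IsCmp n (Term.func f ss) (Term.func g ts) n₁ n₂ n₃ →
      prec ⟨k, f⟩ ⟨m, g⟩ →
      D.Extends n (Fin.elim0 : Fin 0 → ℕ) D' →
      D'.IsPos n (weight wt (Term.func f ss) - weight wt (Term.func g ts)) n₁ n₁ n₃ →
      KBOReplace prec wt D n D'
  | less {k m : ℕ} {f : L.Functions k} {g : L.Functions m}
      {ss : Fin k → L.Term V} {ts : Fin m → L.Term V} {n₁ n₂ n₃ : ℕ} :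
      D.IsCmp n (Term.func f ss) (Term.func g ts) n₁ n₂ n₃ →
      prec ⟨m, g⟩ ⟨k, f⟩ →
      D.Extends n (Fin.elim0 : Fin 0 → ℕ) D' →
      D'.IsPos n (weight wt (Term.func f ss) - weight wt (Term.func g ts)) n₁ n₃ n₃ →
      KBOReplace prec wt D n D'
  | same {k : ℕ} {f : L.Functions k} {ss ts : Fin k → L.Term V} {n₁ n₂ n₃ : ℕ}
      (ν : Fin k → ℕ) :
      D.IsCmp n (Term.func f ss) (Term.func f ts) n₁ n₂ n₃ →
      D.Extends n ν D' →
      D'.IsPos n (weight wt (Term.func f ss) - weight wt (Term.func f ts))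
        n₁ (nodeAt ν n₂ 0) n₃ →
      (∀ i : Fin k, D'.IsCmp (ν i) (ss i) (ts i) n₁ (nodeAt ν n₂ (i + 1)) n₃) →
      KBOReplace prec wt D n D'

/-- The LPO transformations of a node `n` labelled `f(s₁,…,s_k) ? g(t₁,…,t_m)`
with `>`, `=`, `≱` edges to `n₁`, `n₂`, `n₃` (before removal of nodes without incoming edges);
`top` is the node that takes the place of `n`. In the cases with new nodes, `n` itself is
the first node of the new subgraph. -/
inductive LPOReplace (prec : Symb L → Symb L → Prop)
    (D : Diagram L V) (n : ℕ) (D' : Diagram L V) : (top : ℕ) → Prop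
  | greater_const {k : ℕ} {f : L.Functions k} {g : L.Functions 0}
      {ss : Fin k → L.Term V} {ts : Fin 0 → L.Term V} {n₁ n₂ n₃ : ℕ} :
      D.IsCmp n (Term.func f ss) (Term.func g ts) n₁ n₂ n₃ →
      prec ⟨k, f⟩ ⟨0, g⟩ →
      D' = D.replaceNode n n₁ →
      LPOReplace prec D n D' n₁
  | greater {k m : ℕ} {f : L.Functions k} {g : L.Functions (m + 1)}
      {ss : Fin k → L.Term V} {ts : Fin (m + 1) → L.Term V} {n₁ n₂ n₃ : ℕ}
      (ν : Fin m → ℕ) :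
      D.IsCmp n (Term.func f ss) (Term.func g ts) n₁ n₂ n₃ →
      prec ⟨k, f⟩ ⟨m + 1, g⟩ →
      D.Extends n ν D' →
      (∀ i : Fin (m + 1), D'.IsCmp ((Fin.cons n ν : Fin (m + 1) → ℕ) i)
        (Term.func f ss) (ts i) (nodeAt ν n₁ i) n₃ n₃) →
      LPOReplace prec D n D' n
  | less_const {m : ℕ} {f : L.Functions 0} {g : L.Functions m}
      {ss : Fin 0 → L.Term V} {ts : Fin m → L.Term V} {n₁ n₂ n₃ : ℕ} :
      D.IsCmp n (Term.func f ss) (Term.func g ts) n₁ n₂ n₃ →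
      prec ⟨m, g⟩ ⟨0, f⟩ →
      D' = D.replaceNode n n₃ →
      LPOReplace prec D n D' n₃
  | less {k m : ℕ} {f : L.Functions (k + 1)} {g : L.Functions m}
      {ss : Fin (k + 1) → L.Term V} {ts : Fin m → L.Term V} {n₁ n₂ n₃ : ℕ}
      (ν : Fin k → ℕ) :
      D.IsCmp n (Term.func f ss) (Term.func g ts) n₁ n₂ n₃ →
      prec ⟨m, g⟩ ⟨k + 1, f⟩ →
      D.Extends n ν D' →
      (∀ i : Fin (k + 1), D'.IsCmp ((Fin.cons n ν : Fin (k + 1) → ℕ) i)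
        (ss i) (Term.func g ts) n₁ n₁ (nodeAt ν n₃ i)) →
      LPOReplace prec D n D' n
  | same_const {f : L.Functions 0} {ss ts : Fin 0 → L.Term V} {n₁ n₂ n₃ : ℕ} :
      D.IsCmp n (Term.func f ss) (Term.func f ts) n₁ n₂ n₃ →
      D' = D.replaceNode n n₂ →
      LPOReplace prec D n D' n₂
  /- The new nodes of the left, middle and right column are `left i`, `mid i`, `right i`, where
  the index `i` (from `0`) stands for argument position `i + 2`;
  `n` is the middle node for position `1`. -/
  | same {k : ℕ} {f : L.Functions (k + 1)} {ss ts : Fin (k + 1) → L.Term V} {n₁ n₂ n₃ : ℕ}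
      (left mid right : Fin k → ℕ) :
      D.IsCmp n (Term.func f ss) (Term.func f ts) n₁ n₂ n₃ →
      D.Extends n (Sum.elim left (Sum.elim mid right)) D' →
      (∀ i : Fin (k + 1), D'.IsCmp ((Fin.cons n mid : Fin (k + 1) → ℕ) i)
        (ss i) (ts i) (nodeAt left n₁ i) (nodeAt mid n₂ i) (nodeAt right n₃ i)) →
      (∀ i : Fin k, D'.IsCmp (left i) (Term.func f ss) (ts i.succ)
        (nodeAt left n₁ (i + 1)) n₃ n₃) →
      (∀ i : Fin k, D'.IsCmp (right i) (ss i.succ) (Term.func f ts)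
        n₁ n₁ (nodeAt right n₃ (i + 1))) →
      LPOReplace prec D n D' n

/-- The ordering-specific transformations at `n`: the KBO transformations if the ordering is a KBO,
the LPO transformations if it is an LPO, and none otherwise; followed by the removal of nodes
without incoming edges. The node `top` takes the place of `n`. -/
def SpecificTransformation (ord : TermOrdering L V) (D : Diagram L V) (n : ℕ)
    (D' : Diagram L V) (top : ℕ) : Prop :=
  match ord with
  | .kbo prec _ wt => ∃ D₁, KBOReplace prec wt D n D₁ ∧ Cleanup D₁ D' ∧ top = n
  | .lpo prec _ => ∃ D₁, LPOReplace prec D n D₁ top ∧ Cleanup D₁ D'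
  | .other _ _ => False

/-- The TOD transformations. -/
inductive Transformation (ord : TermOrdering L V) (D D' : Diagram L V) : Prop
  | redundant (m : ℕ) (ℓ' : Option EdgeLabel) (n : ℕ) (ℓ : EdgeLabel) (n₂ : ℕ) :
      D.RedundantNodeRemoval ord m ℓ' n ℓ n₂ D' → Transformation ord D D'
  | replication (m : ℕ) (ℓ : Option EdgeLabel) (n n₂ : ℕ) :
      D.NodeReplication m ℓ n n₂ D' → Transformation ord D D'
  | specific (n top : ℕ) :
      D.SpecificTransformation ord n D' top → Transformation ord D D'

end Diagram

/-! ## Retrieval -/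

/-- `F` is a forcing function: a partial function from paths (of TODs) to edge labels such that,
whenever `F` is defined on a path from the root, every extension of this path
by an edge that is a `σ`-path for some `σ` ends with an edge labelled by the value of `F`.
`F D π n` is the value on the path `π` of `D` from the root to `n`. -/
def IsForcingFunction (ord : TermOrdering L V)
    (F : Diagram L V → List (ℕ × Option EdgeLabel) → ℕ → Option EdgeLabel) : Prop :=
  ∀ D : Diagram L V, D.IsTOD ord → ∀ (σ : Subst L V) (π : List (ℕ × Option EdgeLabel)) (n n' : ℕ)
    (ℓ' : Option EdgeLabel) (ℓ : EdgeLabel),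
    D.IsPath D.root π n → D.Edge n ℓ' n' → D.IsSubstPath ord σ (π ++ [(n, ℓ')]) →
    F D π n = some ℓ → ℓ' = some ℓ

/-- The index: a diagram and its set of visited nodes. -/
structure Index (L : FirstOrder.Language.{u, v}) (V : Type w) where
  diag : Diagram L V
  visited : Finset ℕ

/-- The state of a running retrieval: the index, the path followed, and the current node. -/
structure Config (L : FirstOrder.Language.{u, v}) (V : Type w) extends Index L V where
  path : List (ℕ × Option EdgeLabel)
  node : ℕ

/-- The traversal starts in the successor of the root node. -/
def Index.start (I : Index L V) : Config L V :=
  { I with path := [(I.diag.root, none)], node := I.diag.next I.diag.root none }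

namespace Config

/-- The configuration `c` after changing the diagram to `D'` and the current node to `n'`
(nodes that have been removed are no longer visited). -/
def change (c : Config L V) (D' : Diagram L V) (n' : ℕ) : Config L V :=
  { diag := D', visited := c.visited.filter (· ∈ D'.nodes), path := c.path, node := n' }

/-- The current node is an unvisited evaluation or success node. -/
def Unvisited (c : Config L V) : Prop :=
  c.node ∉ c.visited ∧ ((c.diag.label c.node).IsEval ∨ (c.diag.label c.node).IsSuccess)

/-- Follow the only edge of a visited success node. -/
def StepSuccess (c c' : Config L V) : Prop :=
  c.node ∈ c.visited ∧ (c.diag.label c.node).IsSuccess ∧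
    c' = { c with path := c.path ++ [(c.node, none)], node := c.diag.next c.node none }

/-- Follow the edge of a visited evaluation node that is chosen by `σ`. -/
def StepFollow (ord : TermOrdering L V) (σ : Subst L V) (c c' : Config L V) : Prop :=
  c.node ∈ c.visited ∧ (c.diag.label c.node).IsEval ∧
    c' = { c with
      path := c.path ++ [(c.node, ord.eval σ (c.diag.label c.node))]
      node := c.diag.next c.node (ord.eval σ (c.diag.label c.node)) }

/-- An unvisited node with more than one incoming edge is replicated,
and the traversal continues with the copy, whose only incoming edge is the one just followed. -/
def StepReplicate (c c' : Config L V) : Prop :=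
  c.Unvisited ∧ (c.diag.inEdges c.node).Nontrivial ∧
    ∃ (π : List (ℕ × Option EdgeLabel)) (m : ℕ) (ℓ : Option EdgeLabel) (n₂ : ℕ) (D' : Diagram L V),
      c.path = π ++ [(m, ℓ)] ∧ c.diag.NodeReplication m ℓ c.node n₂ D' ∧ c' = c.change D' n₂

/-- If `F` gives the label `ℓ`, an unvisited evaluation node with a single incoming edge
is bypassed along its `ℓ` edge. (That it forces `ℓ` is not required here.) -/
def StepRemove (F : Diagram L V → List (ℕ × Option EdgeLabel) → ℕ → Option EdgeLabel)
    (c c' : Config L V) : Prop :=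
  c.Unvisited ∧ (c.diag.inEdges c.node).Subsingleton ∧
    ∃ (π : List (ℕ × Option EdgeLabel)) (m : ℕ) (ℓ' : Option EdgeLabel) (ℓ : EdgeLabel) (n₂ : ℕ)
      (D' : Diagram L V),
      c.path = π ++ [(m, ℓ')] ∧ F c.diag c.path c.node = some ℓ ∧
      c.diag.Bypass m ℓ' c.node ℓ n₂ D' ∧ c' = c.change D' n₂

/-- A KBO or LPO transformation is applied to an unvisited node with a single incoming edge. -/
def StepTransform (ord : TermOrdering L V) (c c' : Config L V) : Prop :=
  c.Unvisited ∧ (c.diag.inEdges c.node).Subsingleton ∧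
    ∃ (D' : Diagram L V) (top : ℕ),
      c.diag.SpecificTransformation ord c.node D' top ∧ c' = c.change D' top

/-- An unvisited node with a single incoming edge to which neither of the previous two steps
is applicable is marked visited. -/
def StepMark (ord : TermOrdering L V)
    (F : Diagram L V → List (ℕ × Option EdgeLabel) → ℕ → Option EdgeLabel)
    (c c' : Config L V) : Prop :=
  c.Unvisited ∧ (c.diag.inEdges c.node).Subsingleton ∧
    F c.diag c.path c.node = none ∧
    (¬ ∃ D' top, c.diag.SpecificTransformation ord c.node D' top) ∧
    c' = { c with visited := insert c.node c.visited }

/-- One step of the retrieval algorithm for the query substitution `σ`. -/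
inductive Step (ord : TermOrdering L V)
    (F : Diagram L V → List (ℕ × Option EdgeLabel) → ℕ → Option EdgeLabel)
    (σ : Subst L V) (c c' : Config L V) : Prop
  | success : StepSuccess c c' → Step ord F σ c c'
  | replicate : StepReplicate c c' → Step ord F σ c c'
  | remove : StepRemove F c c' → Step ord F σ c c'
  | transform : StepTransform ord c c' → Step ord F σ c c'
  | mark : StepMark ord F c c' → Step ord F σ c c'
  | follow : StepFollow ord σ c c' → Step ord F σ c c'

/-- The retrieval may stop in `c`: at the exit node, or (if only one candidate is wanted)
at a success node. -/
def Final (c : Config L V) : Prop :=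
  c.node = c.diag.exit ∨ (c.diag.label c.node).IsSuccess

end Config

namespace Index

/-- The configuration `c` occurs in a retrieval from `I` for `σ`. -/
def Reaches (ord : TermOrdering L V)
    (F : Diagram L V → List (ℕ × Option EdgeLabel) → ℕ → Option EdgeLabel)
    (σ : Subst L V) (I : Index L V) (c : Config L V) : Prop :=
  Relation.ReflTransGen (Config.Step ord F σ) I.start c

/-- A retrieval from `I` for `σ` ends with the index `I'`. -/
def Retrieval (ord : TermOrdering L V)
    (F : Diagram L V → List (ℕ × Option EdgeLabel) → ℕ → Option EdgeLabel)
    (σ : Subst L V) (I I' : Index L V) : Prop :=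
  ∃ c, Reaches ord F σ I c ∧ c.Final ∧ c.toIndex = I'

/-- Insertion of the equality `l ≃ r`: a new comparison node `a` labelled `l ? r` is put just
before the exit node; its `>` edge leads to a new success node `b`, and its other edges
and the edge of `b` lead to the exit node. -/
def Insertion (l r : L.Term V) (I I' : Index L V) : Prop :=
  ∃ a b : ℕ, a ∉ I.diag.nodes ∧ b ∉ I.diag.nodes ∧ a ≠ b ∧
    I' =
      { diag :=
          { I.diag with
            nodes := insert a (insert b I.diag.nodes)
            label := fun x =>
              if x = a then .cmp l r else if x = b then .success l r else I.diag.label x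
            next := fun x y =>
              if x = a then (if y = some .gt then b else I.diag.exit)
              else if x = b then I.diag.exit
              else if I.diag.next x y = I.diag.exit then a
              else I.diag.next x y }
        visited := I.visited }

/-- The indexes that arise from a TOD without visited nodes by insertions and retrievals.
(Deleting an equality does not change the index.) -/
inductive Arises (ord : TermOrdering L V)
    (F : Diagram L V → List (ℕ × Option EdgeLabel) → ℕ → Option EdgeLabel) : Index L V → Prop
  | init (D : Diagram L V) : D.IsTOD ord → Arises ord F { diag := D, visited := ∅ }
  | insertion {I I' : Index L V} (l r : L.Term V) :
      Arises ord F I → Insertion l r I I' → Arises ord F I'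
  | retrieval {I I' : Index L V} (σ : Subst L V) :
      Arises ord F I → Retrieval ord F σ I I' → Arises ord F I'

end Index

end Diagrams

end TOD

/-! For a fixed `σ` a TOD is deterministic: `σ` runs from any node down to the exit, and its success
set is the set `collect` of success labels met on the run from the root (`PreTOD.successSet_eq`). A
transformation at a node `n` therefore preserves equivalence once the runs before and after it
collect the same labels. This is proved by downward induction along the run of `σ`
(`PreTOD.collect_eq_of_step`). Only nodes that `σ` reaches from the root are compared, so a bypass
of `n` may use a label that is forced merely for those substitutions whose traversal contains `n`.

The KBO and LPO transformations replace `n` by a subgraph of comparisons whose exit edge for `σ` is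
the one `n` itself would have chosen (`Refines`). For KBO the subgraph tests the clauses of the
definition in order. For LPO it skips some comparisons the definition mentions; these are decided by
the fact that a term greater than or equal to `t` is greater than every argument of `t`
(`LPO.arg_of_ge`).

Between a change and the subsequent cleanup a diagram may contain unreachable nodes. Such diagrams
are handled as `PreTOD`s, with acyclicity expressed by a rank function; a `PreTOD` without orphans
is a TOD (`PreTOD.isTOD`).

The retrieval invariant is that the visited nodes form a tree hanging from the root: each has at
most one incoming edge, which comes from a visited node or the root (`UniquePaths`). All edges of
the path followed start at visited nodes or the root. Hence an unvisited current node with a single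
incoming edge has only one path from the root, namely the one followed. Every traversal through it
starts with this path, so the value of `F` there is forced (`Inv.forces`). Conversely, changes
happen only at unvisited nodes, which have no edges into visited ones, so the tree and the path
followed survive them (`Inv.change`). Insertions touch only edges into the exit, which is never
visited. -/

namespace TOD

/-! ### Weights under substitution, case analysis of KBO and LPO, and values of evaluation nodes. -/

section Orderings

variable {L : FirstOrder.Language.{u, v}} {V : Type w}

theorem Subst.app_func (σ : Subst L V) {k : ℕ} (f : L.Functions k) (ss : Fin k → L.Term V) :
    σ.app (Term.func f ss) = Term.func f fun i => σ.app (ss i) := rfl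

theorem Subst.appLin_sub (wt : Symb L → ℕ) (σ : Subst L V) (e e' : LinExpr V) :
    σ.appLin wt (e - e') = σ.appLin wt e - σ.appLin wt e' := by
  have h : (e - e').2.sum (fun x a => a • weight wt (σ.toFun x)) =
      e.2.sum (fun x a => a • weight wt (σ.toFun x)) -
        e'.2.sum (fun x a => a • weight wt (σ.toFun x)) :=
    Finsupp.sum_sub_index fun x a b => sub_smul a b _
  have h' : (((e - e').1, 0) : LinExpr V) = (e.1, 0) - (e'.1, 0) := by simp
  rw [appLin, appLin, appLin, h, h']
  abel

/-- `Subst.appLin` as an additive homomorphism. -/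
noncomputable def Subst.appLinHom (wt : Symb L → ℕ) (σ : Subst L V) :
    LinExpr V →+ LinExpr V :=
  AddMonoidHom.ofMapSub (σ.appLin wt) (σ.appLin_sub wt)

/-- Substitution acts additively on linear expressions and has the right value on variables. This
lets a positivity check on `|s| - |t|` under `σ` be read as the weight test in the KBO comparison of
`sσ` and `tσ`. -/
theorem Subst.weight_app (wt : Symb L → ℕ) (σ : Subst L V) (t : L.Term V) :
    weight wt (σ.app t) = σ.appLin wt (weight wt t) := by
  induction t with
  | var x =>
    have h : σ.app (Term.var x) = σ.toFun x := rfl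
    simp [h, weight, appLin, Finsupp.sum_single_index, ← Prod.zero_eq_mk]
  | @func k f ts ih =>
    change _ = σ.appLinHom wt _
    rw [app_func, weight, weight, map_add, map_sum]
    congr 1
    exact Finset.sum_congr rfl fun i _ => ih i

theorem linNonneg_of_linPos {wt : Symb L → ℕ} {e : LinExpr V} (h : LinPos wt e) :
    LinNonneg wt e := fun σ hσ => (h σ hσ).le

theorem linNonneg_zero (wt : Symb L → ℕ) : LinNonneg wt (0 : LinExpr V) := by
  intro σ _
  simp [Subst.appLin]

/-- Used to refute `s ≻ t`; for this, clause (K3) only needs to contribute the equality of the head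
symbols. -/
theorem KBO.cases_func {prec : Symb L → Symb L → Prop} {wt : Symb L → ℕ} {k m : ℕ}
    {f : L.Functions k} {g : L.Functions m} {ss : Fin k → L.Term V} {ts : Fin m → L.Term V}
    (h : KBO prec wt (Term.func f ss) (Term.func g ts)) :
    LinPos wt (weight wt (Term.func f ss) - weight wt (Term.func g ts)) ∨
      LinNonneg wt (weight wt (Term.func f ss) - weight wt (Term.func g ts)) ∧
        (prec ⟨k, f⟩ ⟨m, g⟩ ∨ (⟨k, f⟩ : Symb L) = ⟨m, g⟩) := by
  cases h with
  | weight_gt h => exact .inl h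
  | prec h h' => exact .inr ⟨h, .inl h'⟩
  | lex i h _ _ => exact .inr ⟨h, .inr rfl⟩

theorem KBO.cases_same {prec : Symb L → Symb L → Prop} (hprec : IsStrictTotalOrder (Symb L) prec)
    {wt : Symb L → ℕ} {k : ℕ} {f : L.Functions k} {ss ts : Fin k → L.Term V}
    (h : KBO prec wt (Term.func f ss) (Term.func f ts)) :
    LinPos wt (weight wt (Term.func f ss) - weight wt (Term.func f ts)) ∨
      ∃ i, KBO prec wt (ss i) (ts i) ∧ ∀ j, j < i → ss j = ts j := by
  cases h with
  | weight_gt h => exact .inl h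
  | prec h h' => exact absurd h' (hprec.irrefl _)
  | lex i _ h h' => exact .inr ⟨i, h, h'⟩

/-- A term that is greater than another one is greater than its arguments. -/
theorem LPO.gt_arg {prec : Symb L → Symb L → Prop} {u : L.Term V} {m : ℕ} {g : L.Functions m}
    {ts : Fin m → L.Term V} (h : LPO prec u (Term.func g ts)) (j : Fin m) :
    LPO prec u (ts j) := by
  generalize ht : Term.func g ts = t at h
  induction h with
  | lex i heq hi hj _ _ =>
    cases ht
    -- Before position `i` the arguments coincide, so `ts j` is itself an argument of the larger
    -- term; at `i` it is exceeded by such an argument; after `i` the lexicographic clause demands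
    -- the claim.
    rcases lt_trichotomy j i with hji | rfl | hij
    · rw [← heq j hji]; exact .arg_eq j
    · exact .arg_gt j hi
    · exact hj j hij
  | prec _ h _ => cases ht; exact h j
  | arg_gt i _ ih => exact .arg_gt i (ih ht)
  | arg_eq i =>
    have h : LPO prec (Term.func g ts) (ts j) := .arg_eq j
    exact .arg_gt i (ht ▸ h)

/-- Here and in `LPO.cases_same` the remaining conditions of the lexicographic and precedence
clauses are dropped, since the case analysis only serves to refute `s ≻ t`. -/
theorem LPO.cases_func {prec : Symb L → Symb L → Prop} {k m : ℕ}
    {f : L.Functions k} {g : L.Functions m} {ss : Fin k → L.Term V} {ts : Fin m → L.Term V}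
    (h : LPO prec (Term.func f ss) (Term.func g ts)) :
    (⟨k, f⟩ : Symb L) = ⟨m, g⟩ ∨ prec ⟨k, f⟩ ⟨m, g⟩ ∨
      ∃ i, LPO prec (ss i) (Term.func g ts) ∨ ss i = Term.func g ts := by
  generalize ht : Term.func g ts = t at h
  cases h with
  | lex i _ _ _ => cases ht; exact .inl rfl
  | prec h _ => cases ht; exact .inr (.inl h)
  | arg_gt i h => exact .inr (.inr ⟨i, .inl h⟩)
  | arg_eq i => exact .inr (.inr ⟨i, .inr rfl⟩)

theorem LPO.cases_same {prec : Symb L → Symb L → Prop}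
    (hprec : IsStrictTotalOrder (Symb L) prec) {k : ℕ}
    {f : L.Functions k} {ss ts : Fin k → L.Term V}
    (h : LPO prec (Term.func f ss) (Term.func f ts)) :
    (∃ i, (∀ j, j < i → ss j = ts j) ∧ LPO prec (ss i) (ts i)) ∨
      ∃ i, LPO prec (ss i) (Term.func f ts) ∨ ss i = Term.func f ts := by
  generalize ht : Term.func f ts = t at h
  cases h with
  | lex i h h' _ => cases ht; exact .inl ⟨i, h, h'⟩
  | prec h _ => cases ht; exact absurd h (hprec.irrefl _)
  | arg_gt i h => exact .inr ⟨i, .inl h⟩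
  | arg_eq i => exact .inr ⟨i, .inr rfl⟩

theorem LPO.of_arg {prec : Symb L → Symb L → Prop} {k : ℕ} {f : L.Functions k}
    {ss : Fin k → L.Term V} {t : L.Term V} {i : Fin k} (h : LPO prec (ss i) t ∨ ss i = t) :
    LPO prec (Term.func f ss) t := by
  rcases h with h | rfl
  · exact .arg_gt i h
  · exact .arg_eq i

/-- A term that is greater than or equal to another one is greater than its arguments. -/
theorem LPO.arg_of_ge {prec : Symb L → Symb L → Prop} {u : L.Term V} {m : ℕ} {g : L.Functions m}
    {ts : Fin m → L.Term V} (h : LPO prec u (Term.func g ts) ∨ u = Term.func g ts) (j : Fin m) :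
    LPO prec u (ts j) := by
  rcases h with h | rfl
  · exact h.gt_arg j
  · exact .arg_eq j

theorem evalCmp_eq_gt {ord : TermOrdering L V} {σ : Subst L V} {s t : L.Term V} :
    ord.evalCmp σ s t = .gt ↔ ord.gt (σ.app s) (σ.app t) := by
  unfold TermOrdering.evalCmp
  split_ifs <;> simp_all

theorem evalCmp_eq_eq {ord : TermOrdering L V} {σ : Subst L V} {s t : L.Term V} :
    ord.evalCmp σ s t = .eq ↔ ¬ ord.gt (σ.app s) (σ.app t) ∧ σ.app s = σ.app t := by
  unfold TermOrdering.evalCmp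
  split_ifs <;> simp_all

theorem evalCmp_eq_ngeq {ord : TermOrdering L V} {σ : Subst L V} {s t : L.Term V} :
    ord.evalCmp σ s t = .ngeq ↔ ¬ ord.gt (σ.app s) (σ.app t) ∧ σ.app s ≠ σ.app t := by
  unfold TermOrdering.evalCmp
  split_ifs <;> simp_all

theorem evalCmp_cases (ord : TermOrdering L V) (σ : Subst L V) (s t : L.Term V) :
    ord.evalCmp σ s t = .gt ∨ ord.evalCmp σ s t = .eq ∨ ord.evalCmp σ s t = .ngeq := by
  unfold TermOrdering.evalCmp
  split_ifs <;> simp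

theorem evalPos_cases (ord : TermOrdering L V) (σ : Subst L V) (e : LinExpr V) :
    ord.evalPos σ e = .gt ∨ ord.evalPos σ e = .geq ∨ ord.evalPos σ e = .ngeq := by
  cases ord <;> simp only [TermOrdering.evalPos]
  · split_ifs <;> simp
  all_goals simp

theorem NodeLabel.eval_mem_out (ord : TermOrdering L V) (σ : Subst L V) {c : NodeLabel L V}
    (hc : c ≠ .exit) : ord.eval σ c ∈ c.out := by
  cases c with
  | root => rfl
  | exit => exact absurd rfl hc
  | cmp s t =>
    rcases evalCmp_cases ord σ s t with h | h | h <;> simp [TermOrdering.eval, out, h]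
  | pos e =>
    rcases evalPos_cases ord σ e with h | h | h <;> simp [TermOrdering.eval, out, h]
  | success l r => rfl

/-- Nodes that are not evaluation nodes have at most the unlabelled edge, which is also their value
under `σ`. So a `σ`-path, constrained by definition only at evaluation nodes, follows `ord.eval σ`
everywhere. -/
theorem NodeLabel.eq_eval_of_mem_out (ord : TermOrdering L V) (σ : Subst L V) {c : NodeLabel L V}
    {ℓ : Option EdgeLabel} (h : ℓ ∈ c.out) (h' : c.IsEval → ℓ = ord.eval σ c) :
    ℓ = ord.eval σ c := by
  cases c with
  | root => exact h
  | exit => exact absurd h (Set.notMem_empty _)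
  | cmp s t => exact h' trivial
  | pos e => exact h' trivial
  | success l r => exact h

section KBO

variable {prec : Symb L → Symb L → Prop} {hprec : IsStrictTotalOrder (Symb L) prec}
  {wt : Symb L → ℕ} {σ : Subst L V} {s t : L.Term V}

theorem evalPos_weight_eq_gt :
    (TermOrdering.kbo prec hprec wt).evalPos σ (weight wt s - weight wt t) = .gt ↔
      LinPos wt (weight wt (σ.app s) - weight wt (σ.app t)) := by
  rw [σ.weight_app, σ.weight_app, ← σ.appLin_sub]
  simp only [TermOrdering.evalPos]
  split_ifs <;> simp_all

theorem evalPos_weight_eq_geq :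
    (TermOrdering.kbo prec hprec wt).evalPos σ (weight wt s - weight wt t) = .geq ↔
      ¬ LinPos wt (weight wt (σ.app s) - weight wt (σ.app t)) ∧
        LinNonneg wt (weight wt (σ.app s) - weight wt (σ.app t)) := by
  rw [σ.weight_app, σ.weight_app, ← σ.appLin_sub]
  simp only [TermOrdering.evalPos]
  split_ifs <;> simp_all

theorem evalPos_weight_eq_ngeq :
    (TermOrdering.kbo prec hprec wt).evalPos σ (weight wt s - weight wt t) = .ngeq ↔
      ¬ LinNonneg wt (weight wt (σ.app s) - weight wt (σ.app t)) := by
  rw [σ.weight_app, σ.weight_app, ← σ.appLin_sub]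
  simp only [TermOrdering.evalPos]
  split_ifs with h h'
  · simpa using linNonneg_of_linPos h
  · simpa using h'
  · simpa using h'

end KBO

end Orderings

namespace Diagram

/-! ### Diagrams up to unreachable nodes, runs, and cleanup. -/

section PreTOD

variable {L : FirstOrder.Language.{u, v}} {V : Type w} {ord : TermOrdering L V}
  {D D' : Diagram L V}

/-- Diagrams that are TODs up to nodes that are not reachable from the root. -/
structure PreTOD (ord : TermOrdering L V) (D : Diagram L V) : Prop where
  root_mem : D.root ∈ D.nodes
  label_root : ∀ n ∈ D.nodes, (D.label n = .root ↔ n = D.root)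
  label_exit : ∀ n ∈ D.nodes, (D.label n = .exit ↔ n = D.exit)
  target_mem : ∀ m ℓ n, D.Edge m ℓ n → n ∈ D.nodes
  ne_root : ∀ m ℓ n, D.Edge m ℓ n → n ≠ D.root
  exists_rank : ∃ r : ℕ → ℕ, ∀ m ℓ n, D.Edge m ℓ n → r n < r m
  pos_kbo : ∀ n ∈ D.nodes, ∀ e, D.label n = .pos e → ord.IsKBO

/-- Every node other than the root has an incoming edge. -/
def NoOrphan (D : Diagram L V) : Prop :=
  ∀ n ∈ D.nodes, n ≠ D.root → (D.inEdges n).Nonempty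

/-- The evaluation step of `σ` that leaves the node `a` leads to `b`. -/
def SubstStep (ord : TermOrdering L V) (D : Diagram L V) (σ : Subst L V) (a b : ℕ) : Prop :=
  a ∈ D.nodes ∧ a ≠ D.exit ∧ D.next a (ord.eval σ (D.label a)) = b

/-- A `SubstStep` that leaves an evaluation node. -/
def EvalStep (ord : TermOrdering L V) (D : Diagram L V) (σ : Subst L V) (a b : ℕ) : Prop :=
  a ∈ D.nodes ∧ (D.label a).IsEval ∧ D.next a (ord.eval σ (D.label a)) = b

/-- The labels of the success nodes that `σ` visits after `a`. -/
def collect (ord : TermOrdering L V) (D : Diagram L V) (σ : Subst L V) (a : ℕ) :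
    Set (L.Term V × L.Term V) :=
  {q | ∃ n ∈ D.nodes, Relation.ReflTransGen (D.SubstStep ord σ) a n ∧
    D.label n = .success q.1 q.2}

theorem PreTOD.ne_exit_of_isEval (h : D.PreTOD ord) {n : ℕ} (hn : n ∈ D.nodes)
    (he : (D.label n).IsEval) : n ≠ D.exit := by
  intro h'
  rw [(h.label_exit n hn).2 h'] at he
  exact he

theorem PreTOD.ne_root_of_isEval (h : D.PreTOD ord) {n : ℕ} (hn : n ∈ D.nodes)
    (he : (D.label n).IsEval) : n ≠ D.root := by
  intro h'
  rw [(h.label_root n hn).2 h'] at he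
  exact he

theorem PreTOD.ne_exit_of_isSuccess (h : D.PreTOD ord) {n : ℕ} (hn : n ∈ D.nodes)
    (he : (D.label n).IsSuccess) : n ≠ D.exit := by
  intro h'
  rw [(h.label_exit n hn).2 h'] at he
  exact he

theorem PreTOD.ne_root_of_isSuccess (h : D.PreTOD ord) {n : ℕ} (hn : n ∈ D.nodes)
    (he : (D.label n).IsSuccess) : n ≠ D.root := by
  intro h'
  rw [(h.label_root n hn).2 h'] at he
  exact he

theorem PreTOD.ne_exit_of_edge (h : D.PreTOD ord) {m n : ℕ} {ℓ : Option EdgeLabel}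
    (he : D.Edge m ℓ n) : m ≠ D.exit := by
  intro h'
  have := he.2.1
  rw [(h.label_exit m he.1).2 h'] at this
  exact this

theorem PreTOD.edge_eval (h : D.PreTOD ord) (σ : Subst L V) {a : ℕ} (ha : a ∈ D.nodes)
    (ha' : a ≠ D.exit) :
    D.Edge a (ord.eval σ (D.label a)) (D.next a (ord.eval σ (D.label a))) :=
  ⟨ha, NodeLabel.eval_mem_out ord σ fun h' => ha' ((h.label_exit a ha).1 h'), rfl⟩

theorem PreTOD.next_mem (h : D.PreTOD ord) (σ : Subst L V) {a : ℕ} (ha : a ∈ D.nodes)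
    (ha' : a ≠ D.exit) : D.next a (ord.eval σ (D.label a)) ∈ D.nodes :=
  h.target_mem _ _ _ (h.edge_eval σ ha ha')

theorem PreTOD.substStep_of_evalStep (h : D.PreTOD ord) {σ : Subst L V} {a b : ℕ}
    (hab : D.EvalStep ord σ a b) : D.SubstStep ord σ a b :=
  ⟨hab.1, h.ne_exit_of_isEval hab.1 hab.2.1, hab.2.2⟩

/-- The recursion equation for `collect`, through which collected labels in two diagrams are
compared. -/
theorem collect_step (σ : Subst L V) {a : ℕ} (ha : a ∈ D.nodes)
    (ha' : a ≠ D.exit) :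
    D.collect ord σ a = {q | D.label a = .success q.1 q.2} ∪
      D.collect ord σ (D.next a (ord.eval σ (D.label a))) := by
  ext q
  constructor
  · rintro ⟨n, hn, hr, hq⟩
    rcases Relation.ReflTransGen.cases_head hr with rfl | ⟨c, hc, hr⟩
    · exact .inl hq
    · exact .inr ⟨n, hn, by rwa [hc.2.2], hq⟩
  · rintro (hq | ⟨n, hn, hr, hq⟩)
    · exact ⟨a, ha, .refl, hq⟩
    · exact ⟨n, hn, hr.head ⟨ha, ha', rfl⟩, hq⟩

theorem PreTOD.collect_evalStep (h : D.PreTOD ord) {σ : Subst L V} {a b : ℕ}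
    (hab : D.EvalStep ord σ a b) : D.collect ord σ a = D.collect ord σ b := by
  obtain ⟨ha, he, rfl⟩ := hab
  rw [collect_step σ ha (h.ne_exit_of_isEval ha he)]
  convert Set.empty_union _
  refine Set.eq_empty_of_forall_notMem fun q hq => ?_
  have hq : D.label a = .success q.1 q.2 := hq
  rw [hq] at he
  exact he

theorem PreTOD.collect_evalSteps (h : D.PreTOD ord) {σ : Subst L V} {a b : ℕ}
    (hab : Relation.ReflTransGen (D.EvalStep ord σ) a b) :
    D.collect ord σ a = D.collect ord σ b := by
  induction hab with
  | refl => rfl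
  | tail _ hbc ih => rw [ih, h.collect_evalStep hbc]

/-- At a node that both diagrams have with the same label, equality of the collected labels
follows from that at the targets. -/
theorem collect_eq_of_next {σ : Subst L V} {a a' : ℕ} (ha : a ∈ D.nodes)
    (ha' : a' ∈ D'.nodes) (hx : a ≠ D.exit) (hx' : a' ≠ D'.exit) (hl : D'.label a' = D.label a)
    (h : D.collect ord σ (D.next a (ord.eval σ (D.label a))) =
      D'.collect ord σ (D'.next a' (ord.eval σ (D'.label a')))) :
    D.collect ord σ a = D'.collect ord σ a' := by
  rw [collect_step σ ha hx, collect_step σ ha' hx', h, hl]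

theorem PreTOD.collect_exit (h : D.PreTOD ord) (σ : Subst L V) :
    D.collect ord σ D.exit = ∅ := by
  refine Set.eq_empty_of_forall_notMem ?_
  rintro q ⟨n, hn, hr, hq⟩
  rcases Relation.ReflTransGen.cases_head hr with rfl | ⟨c, hc, -⟩
  · rw [(h.label_exit _ hn).2 rfl] at hq
    cases hq
  · exact hc.2.1 rfl

theorem IsPath.append {a b c : ℕ} {π π' : List (ℕ × Option EdgeLabel)}
    (h : D.IsPath a π b) (h' : D.IsPath b π' c) : D.IsPath a (π ++ π') c := by
  induction h with
  | nil _ => exact h'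
  | cons he _ ih => exact .cons he (ih h')

theorem isPath_append_iff {a c : ℕ} {π π' : List (ℕ × Option EdgeLabel)} :
    D.IsPath a (π ++ π') c ↔ ∃ b, D.IsPath a π b ∧ D.IsPath b π' c := by
  refine ⟨fun h => ?_, fun ⟨b, h, h'⟩ => h.append h'⟩
  induction π generalizing a with
  | nil =>
    refine ⟨a, .nil ?_, h⟩
    cases h with
    | nil h => exact h
    | cons h _ => exact h.1
  | cons p π ih =>
    cases h with
    | cons he h =>
      obtain ⟨b, hb, hb'⟩ := ih h
      exact ⟨b, .cons he hb, hb'⟩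

theorem isPath_nil_iff {a b : ℕ} : D.IsPath a [] b ↔ a = b ∧ a ∈ D.nodes := by
  constructor
  · rintro ⟨h⟩
    exact ⟨rfl, h⟩
  · rintro ⟨rfl, h⟩
    exact .nil h

theorem isPath_cons_iff {a b m : ℕ} {ℓ : Option EdgeLabel} {π : List (ℕ × Option EdgeLabel)} :
    D.IsPath a ((m, ℓ) :: π) b ↔ m = a ∧ ∃ c, D.Edge a ℓ c ∧ D.IsPath c π b := by
  constructor
  · rintro (_ | ⟨he, h⟩)
    exact ⟨rfl, _, he, h⟩
  · rintro ⟨rfl, c, he, h⟩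
    exact .cons he h

theorem PreTOD.isPath_concat_iff (h : D.PreTOD ord) {a b m : ℕ} {ℓ : Option EdgeLabel}
    {π : List (ℕ × Option EdgeLabel)} :
    D.IsPath a (π ++ [(m, ℓ)]) b ↔ D.IsPath a π m ∧ D.Edge m ℓ b := by
  rw [isPath_append_iff]
  constructor
  · rintro ⟨c, hc, hb⟩
    obtain ⟨rfl, d, he, hd⟩ := isPath_cons_iff.1 hb
    obtain ⟨rfl, -⟩ := isPath_nil_iff.1 hd
    exact ⟨hc, he⟩
  · rintro ⟨hp, he⟩
    exact ⟨m, hp, .cons he (.nil (h.target_mem _ _ _ he))⟩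

theorem PreTOD.isPath_root_nil (h : D.PreTOD ord) : D.IsPath D.root [] D.root :=
  .nil h.root_mem

theorem PreTOD.isPath_to_root (h : D.PreTOD ord) {a : ℕ} {π : List (ℕ × Option EdgeLabel)}
    (hπ : D.IsPath a π D.root) : π = [] := by
  rcases π.eq_nil_or_concat' with rfl | ⟨π, ⟨m, ℓ⟩, rfl⟩
  · rfl
  · exact absurd rfl (h.ne_root _ _ _ (h.isPath_concat_iff.1 hπ).2)

/-- Together with `PreTOD.exists_isPath` this identifies `σ`-paths with runs of a deterministic step
relation, so that success sets can be studied without lists of edges. -/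
theorem IsPath.reflTransGen_substStep (h : D.PreTOD ord) {σ : Subst L V} {a b : ℕ}
    {π : List (ℕ × Option EdgeLabel)} (hπ : D.IsPath a π b) (hσ : D.IsSubstPath ord σ π) :
    Relation.ReflTransGen (D.SubstStep ord σ) a b := by
  induction hπ with
  | nil _ => exact .refl
  | @cons a c b ℓ π he _ ih =>
    refine .head ⟨he.1, h.ne_exit_of_edge he, ?_⟩ (ih fun p hp => hσ p (.tail _ hp))
    rw [← NodeLabel.eq_eval_of_mem_out ord σ he.2.1 (hσ (a, ℓ) (.head _))]
    exact he.2.2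

theorem PreTOD.exists_isPath (h : D.PreTOD ord) {σ : Subst L V} {a b : ℕ}
    (hab : Relation.ReflTransGen (D.SubstStep ord σ) a b) (hb : b ∈ D.nodes) :
    ∃ π, D.IsPath a π b ∧ D.IsSubstPath ord σ π := by
  induction hab using Relation.ReflTransGen.head_induction_on with
  | refl => exact ⟨[], .nil hb, fun p hp => absurd hp List.not_mem_nil⟩
  | @head a c hac _ ih =>
    obtain ⟨π, hπ, hσ⟩ := ih
    obtain ⟨ha, hx, rfl⟩ := hac
    refine ⟨_, .cons (h.edge_eval σ ha hx) hπ, fun p hp => ?_⟩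
    rcases List.mem_cons.1 hp with rfl | hp
    · exact fun _ => rfl
    · exact hσ p hp

/-- A run descends in rank and can stop only at the exit. That the exit is a node at all is not part
of `PreTOD`; it follows because the run ends there. -/
theorem PreTOD.reaches_exit (h : D.PreTOD ord) (σ : Subst L V) {a : ℕ} (ha : a ∈ D.nodes) :
    D.exit ∈ D.nodes ∧ Relation.ReflTransGen (D.SubstStep ord σ) a D.exit := by
  obtain ⟨r, hr⟩ := h.exists_rank
  induction hk : r a using Nat.strong_induction_on generalizing a with
  | _ k ih =>
    by_cases hx : a = D.exit
    · subst hx; exact ⟨ha, .refl⟩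
    · have he := h.edge_eval σ ha hx
      obtain ⟨h1, h2⟩ := ih _ (hk ▸ hr _ _ _ he) (h.target_mem _ _ _ he) rfl
      exact ⟨h1, h2.head ⟨ha, hx, rfl⟩⟩

/-- The identity substitution. -/
def idSubst (L : FirstOrder.Language.{u, v}) (V : Type w) : Subst L V :=
  ⟨Term.var, by simp⟩

theorem PreTOD.exit_mem (h : D.PreTOD ord) : D.exit ∈ D.nodes :=
  (h.reaches_exit (idSubst L V) h.root_mem).1

/-- A node other than the exit that `σ` reaches from the root lies on the traversal for `σ`. -/
theorem PreTOD.exists_traversal (h : D.PreTOD ord) {σ : Subst L V} {n : ℕ} (hn : n ∈ D.nodes)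
    (hx : n ≠ D.exit) (hr : Relation.ReflTransGen (D.SubstStep ord σ) D.root n) :
    ∃ π, D.IsTraversal ord σ π ∧ ∃ p ∈ π, p.1 = n := by
  obtain ⟨π, hπ, hσ⟩ := h.exists_isPath hr hn
  obtain ⟨π', hπ', hσ'⟩ := h.exists_isPath (h.reaches_exit σ hn).2 h.exit_mem
  refine ⟨π ++ π', ⟨hπ.append hπ', fun p hp => ?_⟩, ?_⟩
  · exact (List.mem_append.1 hp).elim (hσ p) (hσ' p)
  · cases hπ' with
    | nil _ => exact absurd rfl hx
    | cons _ _ => exact ⟨_, List.mem_append_right _ (.head _), rfl⟩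

theorem IsPath.exists_split {a b : ℕ} {π : List (ℕ × Option EdgeLabel)}
    (hπ : D.IsPath a π b) {p : ℕ × Option EdgeLabel} (hp : p ∈ π) :
    ∃ π₁ π₂ c, π = π₁ ++ p :: π₂ ∧ D.IsPath a π₁ p.1 ∧ D.Edge p.1 p.2 c ∧ D.IsPath c π₂ b := by
  obtain ⟨π₁, π₂, rfl⟩ := List.append_of_mem hp
  obtain ⟨c, hc, hb⟩ := isPath_append_iff.1 hπ
  obtain ⟨rfl, d, he, hd⟩ := isPath_cons_iff.1 hb
  exact ⟨π₁, π₂, d, rfl, hc, he, hd⟩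

/-- A node reached by the run lies on the traversal because the run can be continued to the exit.
The exit itself, from which no edge of a path starts, carries no success label. -/
theorem PreTOD.successSet_eq (h : D.PreTOD ord) (σ : Subst L V) :
    D.successSet ord σ = D.collect ord σ D.root := by
  ext q
  constructor
  · rintro ⟨π, ⟨hπ, hσ⟩, p, hp, hq⟩
    obtain ⟨π₁, π₂, c, rfl, h₁, he, -⟩ := hπ.exists_split hp
    exact ⟨p.1, he.1, h₁.reflTransGen_substStep h fun x hx => hσ x (by simp [hx]), hq⟩
  · rintro ⟨n, hn, hr, hq⟩
    have hx : n ≠ D.exit := h.ne_exit_of_isSuccess hn (by rw [hq]; trivial)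
    obtain ⟨π, hπ, p, hp, rfl⟩ := h.exists_traversal hn hx hr
    exact ⟨π, hπ, p, hp, hq⟩

theorem PreTOD.equivalent (h : D.PreTOD ord) (h' : D'.PreTOD ord)
    (hc : ∀ σ, D.collect ord σ D.root = D'.collect ord σ D'.root) : D.Equivalent ord D' := by
  intro σ
  rw [h.successSet_eq, h'.successSet_eq, hc]

open Classical in
theorem IsTOD.preTOD (h : D.IsTOD ord) : D.PreTOD ord where
  root_mem := h.root_mem
  label_root := h.label_root
  label_exit := h.label_exit
  target_mem := h.target_mem
  pos_kbo := h.pos_kbo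
  ne_root := by
    rintro m ℓ n he rfl
    exact h.acyclic _ (.tail' (h.reachable_root m he.1) ⟨ℓ, he⟩)
  exists_rank := by
    -- The rank of a node is the number of nodes strictly below it. Along an edge it drops, since
    -- the target is below the source but, by acyclicity, not below itself.
    refine ⟨fun a => (D.nodes.filter (Relation.TransGen D.Adj a ·)).card, fun m ℓ n he => ?_⟩
    refine Finset.card_lt_card ⟨fun x hx => ?_, fun hsub => ?_⟩
    · rw [Finset.mem_filter] at hx ⊢
      exact ⟨hx.1, hx.2.head ⟨ℓ, he⟩⟩
    · have hn := hsub (Finset.mem_filter.2 ⟨h.target_mem _ _ _ he, .single ⟨ℓ, he⟩⟩)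
      exact h.acyclic n (Finset.mem_filter.1 hn).2

theorem IsTOD.noOrphan (h : D.IsTOD ord) : D.NoOrphan := by
  intro n hn hr
  rcases Relation.ReflTransGen.cases_tail (h.reachable_root n hn) with h' | ⟨c, -, ℓ, he⟩
  · exact absurd h' hr
  · exact ⟨(c, ℓ), he⟩

theorem PreTOD.rank_lt_of_transGen {r : ℕ → ℕ} (hr : ∀ m ℓ n, D.Edge m ℓ n → r n < r m) {a b : ℕ}
    (hab : Relation.TransGen D.Adj a b) : r b < r a := by
  induction hab with
  | single h => exact hr _ _ _ h.choose_spec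
  | tail _ h ih => exact (hr _ _ _ h.choose_spec).trans ih

/-- Walking edges backwards raises the rank, which is bounded on the finite set of nodes; without
orphans such a walk can end only at the root. Forwards, the run of any substitution reaches the
exit. -/
theorem PreTOD.isTOD (h : D.PreTOD ord) (ho : D.NoOrphan) : D.IsTOD ord where
  root_mem := h.root_mem
  exit_mem := h.exit_mem
  label_root := h.label_root
  label_exit := h.label_exit
  target_mem := h.target_mem
  pos_kbo := h.pos_kbo
  acyclic n hn := by
    obtain ⟨r, hr⟩ := h.exists_rank
    exact (rank_lt_of_transGen hr hn).false
  reachable_root n hn := by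
    obtain ⟨r, hr⟩ := h.exists_rank
    obtain ⟨K, hK⟩ : ∃ K, ∀ a ∈ D.nodes, r a ≤ K :=
      ⟨D.nodes.sup r, fun a ha => Finset.le_sup ha⟩
    induction hk : K - r n using Nat.strong_induction_on generalizing n with
    | _ k ih =>
      by_cases hnr : n = D.root
      · rw [hnr]
      · obtain ⟨⟨m, ℓ⟩, he⟩ := ho n hn hnr
        have h1 := hr _ _ _ he
        have h2 := hK m he.1
        exact (ih (K - r m) (by simp only at h1 h2; omega) m he.1 rfl).tail ⟨ℓ, he⟩
  reaches_exit n hn := by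
    refine (h.reaches_exit (idSubst L V) hn).2.lift id ?_
    rintro a b ⟨ha, hx, rfl⟩
    exact ⟨_, h.edge_eval _ ha hx⟩

/-- `D'` arises from `D` by removing nodes that are not reachable from the root. -/
structure Trims (D D' : Diagram L V) : Prop where
  eq_of_nodes : D' = { D with nodes := D'.nodes }
  sub : D'.nodes ⊆ D.nodes
  root_mem : D.root ∈ D.nodes → D.root ∈ D'.nodes
  target_mem : ∀ m ℓ n, D.Edge m ℓ n → n ∈ D.nodes → m ∈ D'.nodes → n ∈ D'.nodes

theorem Trims.refl (D : Diagram L V) : Trims D D :=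
  ⟨rfl, Finset.Subset.refl _, id, fun _ _ _ _ h _ => h⟩

theorem Trims.root_eq (h : Trims D D') : D'.root = D.root := by rw [h.eq_of_nodes]
theorem Trims.exit_eq (h : Trims D D') : D'.exit = D.exit := by rw [h.eq_of_nodes]
theorem Trims.label_eq (h : Trims D D') : D'.label = D.label := by rw [h.eq_of_nodes]
theorem Trims.next_eq (h : Trims D D') : D'.next = D.next := by rw [h.eq_of_nodes]

theorem Trims.edge_iff (h : Trims D D') {m n : ℕ} {ℓ : Option EdgeLabel} :
    D'.Edge m ℓ n ↔ D.Edge m ℓ n ∧ m ∈ D'.nodes := by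
  unfold Edge
  rw [h.label_eq, h.next_eq]
  exact ⟨fun h' => ⟨⟨h.sub h'.1, h'.2⟩, h'.1⟩, fun h' => ⟨h'.2, h'.1.2⟩⟩

theorem Trims.trans {D'' : Diagram L V} (h : Trims D D') (h' : Trims D' D'') : Trims D D'' where
  eq_of_nodes := by rw [h'.eq_of_nodes, h.eq_of_nodes]
  sub := h'.sub.trans h.sub
  root_mem hr := by
    have := h'.root_mem
    rw [h.root_eq] at this
    exact this (h.root_mem hr)
  target_mem m ℓ n he hn hm :=
    h'.target_mem m ℓ n (h.edge_iff.2 ⟨he, h'.sub hm⟩) (h.target_mem m ℓ n he hn (h'.sub hm)) hm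

theorem RemoveOrphan.trims (h : RemoveOrphan D D') : Trims D D' := by
  obtain ⟨n, hn, hr, hin, rfl⟩ := h
  refine ⟨rfl, Finset.erase_subset _ _, fun h => Finset.mem_erase.2 ⟨Ne.symm hr, h⟩, ?_⟩
  intro m ℓ x he hx _
  refine Finset.mem_erase.2 ⟨?_, hx⟩
  rintro rfl
  exact (Set.eq_empty_iff_forall_notMem.1 hin) (m, ℓ) he

theorem Cleanup.trims (h : Cleanup D D') : Trims D D' := by
  obtain ⟨h, -⟩ := h
  induction h with
  | refl => exact .refl D
  | tail _ h ih => exact ih.trans h.trims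

theorem Trims.preTOD (h : Trims D D') (hD : D.PreTOD ord) : D'.PreTOD ord where
  root_mem := h.root_eq ▸ h.root_mem hD.root_mem
  label_root n hn := by rw [h.root_eq, h.label_eq]; exact hD.label_root n (h.sub hn)
  label_exit n hn := by rw [h.exit_eq, h.label_eq]; exact hD.label_exit n (h.sub hn)
  target_mem m ℓ n he := by
    obtain ⟨he, hm⟩ := h.edge_iff.1 he
    exact h.target_mem m ℓ n he (hD.target_mem m ℓ n he) hm
  ne_root m ℓ n he := by rw [h.root_eq]; exact hD.ne_root m ℓ n (h.edge_iff.1 he).1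
  exists_rank := by
    obtain ⟨r, hr⟩ := hD.exists_rank
    exact ⟨r, fun m ℓ n he => hr m ℓ n (h.edge_iff.1 he).1⟩
  pos_kbo n hn e := by rw [h.label_eq]; exact hD.pos_kbo n (h.sub hn) e

theorem Trims.isPath (h : Trims D D') (hD : D.PreTOD ord) {a b : ℕ}
    {π : List (ℕ × Option EdgeLabel)} (hπ : D.IsPath a π b) (ha : a ∈ D'.nodes) :
    D'.IsPath a π b := by
  induction hπ with
  | nil _ => exact .nil ha
  | cons he _ ih =>
    exact .cons (h.edge_iff.2 ⟨he, ha⟩) (ih (h.target_mem _ _ _ he (hD.target_mem _ _ _ he) ha))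

/-- The target of an edge from a remaining node also remains, so a run starting at a remaining node
is unaffected. -/
theorem Trims.collect_eq (h : Trims D D') (hD : D.PreTOD ord) (σ : Subst L V) {a : ℕ}
    (ha : a ∈ D'.nodes) : D.collect ord σ a = D'.collect ord σ a := by
  obtain ⟨r, hr⟩ := hD.exists_rank
  induction hk : r a using Nat.strong_induction_on generalizing a with
  | _ k ih =>
    by_cases hx : a = D.exit
    · rw [hx, hD.collect_exit, ← h.exit_eq, (h.preTOD hD).collect_exit]
    · have hx' : a ≠ D'.exit := by rwa [h.exit_eq]
      refine collect_eq_of_next (h.sub ha) ha hx hx' (by rw [h.label_eq]) ?_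
      have he := hD.edge_eval σ (h.sub ha) hx
      have he' := (h.preTOD hD).next_mem σ ha hx'
      rw [h.label_eq, h.next_eq] at he' ⊢
      exact ih _ (hk ▸ hr _ _ _ he) he' rfl

theorem IsPath.mem_right {a b : ℕ} {π : List (ℕ × Option EdgeLabel)} (hπ : D.IsPath a π b) :
    b ∈ D.nodes := by
  induction hπ with
  | nil h => exact h
  | cons _ _ ih => exact ih

theorem Cleanup.isTOD (h : Cleanup D D') (hD : D.PreTOD ord) : D'.IsTOD ord :=
  (h.trims.preTOD hD).isTOD h.2

theorem IsTOD.cleanup_self (h : D.IsTOD ord) : Cleanup D D := ⟨.refl, h.noOrphan⟩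

end PreTOD

/-! ### Changes at one node that preserve all success sets. -/

section LocalChange

variable {L : FirstOrder.Language.{u, v}} {V : Type w} {ord : TermOrdering L V}
  {D D' : Diagram L V}

/-- `D'` arises from `D` by a change at the node `n` that does not affect any success set. -/
structure LocalChange (ord : TermOrdering L V) (D : Diagram L V) (n : ℕ) (D' : Diagram L V) :
    Prop where
  preTOD : D'.PreTOD ord
  root_eq : D'.root = D.root
  exit_eq : D'.exit = D.exit
  nodes_sub : D.nodes ⊆ D'.nodes
  edge_of : ∀ y ∈ D.nodes, ¬ D.Adj n y → ∀ x ℓ, D'.Edge x ℓ y → D.Edge x ℓ y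
  edge_keep : ∀ x ℓ y, D.Edge x ℓ y → x ≠ n → y ≠ n → D'.Edge x ℓ y
  collect_eq : ∀ σ, D.collect ord σ D.root = D'.collect ord σ D.root

/-- Downward induction along the traversal for `σ`. -/
theorem PreTOD.collect_eq_of_step (h : D.PreTOD ord) (h' : D'.PreTOD ord) (hx : D'.exit = D.exit)
    (σ : Subst L V)
    (hstep : ∀ a ∈ D.nodes, a ≠ D.exit → Relation.ReflTransGen (D.SubstStep ord σ) D.root a →
      (∀ b ∈ D.nodes, Relation.TransGen (D.SubstStep ord σ) a b →
        D.collect ord σ b = D'.collect ord σ b) →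
      D.collect ord σ a = D'.collect ord σ a) :
    D.collect ord σ D.root = D'.collect ord σ D.root := by
  obtain ⟨r, hr⟩ := h.exists_rank
  have hlt : ∀ a b, Relation.TransGen (D.SubstStep ord σ) a b → r b < r a := by
    intro a b hab
    induction hab with
    | single hs => exact hs.2.2 ▸ hr _ _ _ (h.edge_eval σ hs.1 hs.2.1)
    | tail _ hs ih => exact (hs.2.2 ▸ hr _ _ _ (h.edge_eval σ hs.1 hs.2.1)).trans ih
  suffices H : ∀ a ∈ D.nodes, Relation.ReflTransGen (D.SubstStep ord σ) D.root a →
      D.collect ord σ a = D'.collect ord σ a from H _ h.root_mem .refl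
  intro a
  induction hk : r a using Nat.strong_induction_on generalizing a with
  | _ k ih =>
    intro ha har
    by_cases hax : a = D.exit
    · rw [hax, h.collect_exit, ← hx, h'.collect_exit]
    · exact hstep a ha hax har fun b hb hab =>
        ih _ (hk ▸ hlt _ _ hab) b rfl hb (har.trans hab.to_reflTransGen)

/-- The conjunct `D.Edge m ℓ (D.next m ℓ)` says just that there was an edge to redirect. -/
theorem redirect_edge_iff {m n x y : ℕ} {ℓ ℓ' : Option EdgeLabel} :
    (D.redirect m ℓ n).Edge x ℓ' y ↔ (x = m ∧ ℓ' = ℓ ∧ y = n ∧ D.Edge m ℓ (D.next m ℓ)) ∨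
      (¬ (x = m ∧ ℓ' = ℓ) ∧ D.Edge x ℓ' y) := by
  unfold Edge redirect
  by_cases h : x = m ∧ ℓ' = ℓ
  · obtain ⟨rfl, rfl⟩ := h
    simp only [and_self, if_true, not_true, false_and, or_false, true_and]
    tauto
  · simp only [h, not_false_eq_true, true_and]
    tauto

/-- A substitution that takes the redirected edge would have passed through `n` and left it for `n₂`
anyway. The old ranks still work, as `n₂` lies below `n` and `n` below `m`. -/
theorem PreTOD.localChange_redirect (h : D.PreTOD ord) {m n n₂ : ℕ} {ℓ' : Option EdgeLabel}
    {ℓ : EdgeLabel} (hm : D.Edge m ℓ' n) (hn : D.Edge n (some ℓ) n₂)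
    (hf : D.Forces ord n ℓ) : LocalChange ord D n (D.redirect m ℓ' n₂) := by
  have key : ∀ x k y, (D.redirect m ℓ' n₂).Edge x k y →
      (x = m ∧ k = ℓ' ∧ y = n₂) ∨ D.Edge x k y := by
    intro x k y hxy
    rcases redirect_edge_iff.1 hxy with h' | h'
    · exact .inl ⟨h'.1, h'.2.1, h'.2.2.1⟩
    · exact .inr h'.2
  have hpre : (D.redirect m ℓ' n₂).PreTOD ord := by
    refine ⟨h.root_mem, h.label_root, h.label_exit, ?_, ?_, ?_, h.pos_kbo⟩
    · intro x k y hxy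
      rcases key x k y hxy with ⟨-, -, rfl⟩ | h'
      · exact h.target_mem _ _ _ hn
      · exact h.target_mem _ _ _ h'
    · intro x k y hxy
      rcases key x k y hxy with ⟨-, -, rfl⟩ | h'
      · exact h.ne_root _ _ _ hn
      · exact h.ne_root _ _ _ h'
    · obtain ⟨r, hr⟩ := h.exists_rank
      refine ⟨r, fun x k y hxy => ?_⟩
      rcases key x k y hxy with ⟨rfl, -, rfl⟩ | h'
      · exact (hr _ _ _ hn).trans (hr _ _ _ hm)
      · exact hr _ _ _ h'
  refine ⟨hpre, rfl, rfl, Finset.Subset.refl _, ?_, ?_, ?_⟩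
  · intro y _ hy x k hxy
    rcases key x k y hxy with ⟨-, -, rfl⟩ | h'
    · exact absurd ⟨_, hn⟩ hy
    · exact h'
  · intro x k y hxy _ hy
    refine redirect_edge_iff.2 (.inr ⟨?_, hxy⟩)
    rintro ⟨rfl, rfl⟩
    exact hy (hxy.2.2.symm.trans hm.2.2)
  · intro σ
    refine h.collect_eq_of_step hpre rfl σ fun a ha hx har ih => ?_
    refine collect_eq_of_next (D' := D.redirect m ℓ' n₂) ha ha hx hx rfl ?_
    have hs : D.SubstStep ord σ a (D.next a (ord.eval σ (D.label a))) := ⟨ha, hx, rfl⟩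
    have hmem := h.next_mem σ ha hx
    change _ = collect ord _ σ (if a = m ∧ ord.eval σ (D.label a) = ℓ' then n₂ else _)
    split_ifs with hc
    · obtain ⟨rfl, rfl⟩ := hc
      rw [hm.2.2] at hs ⊢
      have hnx := h.ne_exit_of_isEval hn.1 hf.1
      -- Since `σ` reaches `a` from the root, `n` lies on its traversal, and only therefore does
      -- forcing apply to `σ`.
      obtain ⟨π, hπ, hp⟩ := h.exists_traversal hn.1 hnx (har.tail hs)
      have he : D.EvalStep ord σ n n₂ := ⟨hn.1, hf.1, by rw [hf.2 σ π hπ hp]; exact hn.2.2⟩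
      rw [h.collect_evalStep he]
      exact ih _ (h.target_mem _ _ _ hn) (.tail (.single hs) (h.substStep_of_evalStep he))
    · exact ih _ hmem (.single hs)

/-- The diagram resulting from a node replication. -/
def replicate (D : Diagram L V) (m : ℕ) (ℓ : Option EdgeLabel) (n n₂ : ℕ) : Diagram L V :=
  { D with
    nodes := insert n₂ D.nodes
    label := fun a => if a = n₂ then D.label n else D.label a
    next := fun a b =>
      if a = m ∧ b = ℓ then n₂ else if a = n₂ then D.next n b else D.next a b }

theorem replicate_edge {m n n₂ x y : ℕ} {ℓ ℓ' : Option EdgeLabel} (hm : m ∈ D.nodes)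
    (hn : n ∈ D.nodes) (hn₂ : n₂ ∉ D.nodes) (h : (D.replicate m ℓ n n₂).Edge x ℓ' y) :
    (x = m ∧ ℓ' = ℓ ∧ y = n₂) ∨ (x = n₂ ∧ D.Edge n ℓ' y) ∨
      (¬ (x = m ∧ ℓ' = ℓ) ∧ D.Edge x ℓ' y) := by
  obtain ⟨h1, h2, h3⟩ := h
  simp only [replicate] at h1 h2 h3
  by_cases hx : x = n₂
  · subst hx
    have hne : ¬ (x = m ∧ ℓ' = ℓ) := by rintro ⟨rfl, -⟩; exact hn₂ hm
    rw [if_pos rfl] at h2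
    rw [if_neg hne, if_pos rfl] at h3
    exact .inr (.inl ⟨rfl, hn, h2, h3⟩)
  · rw [if_neg hx] at h2 h3
    split_ifs at h3 with hc
    · exact .inl ⟨hc.1, hc.2, h3.symm⟩
    · exact .inr (.inr ⟨hc, (Finset.mem_insert.1 h1).resolve_left hx, h2, h3⟩)

theorem replicate_edge_of_ne {m n n₂ x y : ℕ} {ℓ ℓ' : Option EdgeLabel}
    (hn₂ : n₂ ∉ D.nodes) (hx : ¬ (x = m ∧ ℓ' = ℓ)) (h : D.Edge x ℓ' y) :
    (D.replicate m ℓ n n₂).Edge x ℓ' y := by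
  have hne : x ≠ n₂ := by rintro rfl; exact hn₂ h.1
  refine ⟨Finset.mem_insert_of_mem h.1, ?_, ?_⟩
  · simp only [replicate, if_neg hne]; exact h.2.1
  · simp only [replicate, if_neg hne, if_neg hx]; exact h.2.2

theorem replicate_edge_self {m n n₂ : ℕ} {ℓ : Option EdgeLabel} (hn₂ : n₂ ∉ D.nodes)
    (h : D.Edge m ℓ n) : (D.replicate m ℓ n n₂).Edge m ℓ n₂ := by
  have hne : m ≠ n₂ := by rintro rfl; exact hn₂ h.1
  refine ⟨Finset.mem_insert_of_mem h.1, ?_, ?_⟩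
  · simp only [replicate, if_neg hne]; exact h.2.1
  · simp [replicate]

theorem PreTOD.localChange_replicate (h : D.PreTOD ord) {m n n₂ : ℕ} {ℓ : Option EdgeLabel}
    (hm : D.Edge m ℓ n) (hnx : n ≠ D.exit) (hn₂ : n₂ ∉ D.nodes) :
    LocalChange ord D n (D.replicate m ℓ n n₂) := by
  have hn := h.target_mem _ _ _ hm
  have hnr := h.ne_root _ _ _ hm
  have key := fun x k y => replicate_edge (x := x) (y := y) (ℓ := ℓ) (ℓ' := k) hm.1 hn hn₂
  have hne : ∀ a ∈ D.nodes, a ≠ n₂ := by rintro a ha rfl; exact hn₂ ha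
  have hpre : (D.replicate m ℓ n n₂).PreTOD ord := by
    refine ⟨Finset.mem_insert_of_mem h.root_mem, ?_, ?_, ?_, ?_, ?_, ?_⟩
    · intro a ha
      simp only [replicate] at ha ⊢
      rcases Finset.mem_insert.1 ha with rfl | ha
      · rw [if_pos rfl, h.label_root n hn]
        exact iff_of_false hnr (hne _ h.root_mem).symm
      · rw [if_neg (hne a ha), h.label_root a ha]
    · intro a ha
      simp only [replicate] at ha ⊢
      rcases Finset.mem_insert.1 ha with rfl | ha
      · rw [if_pos rfl, h.label_exit n hn]
        exact iff_of_false hnx (hne _ h.exit_mem).symm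
      · rw [if_neg (hne a ha), h.label_exit a ha]
    · intro x k y hxy
      rcases key x k y hxy with ⟨-, -, rfl⟩ | ⟨-, h'⟩ | ⟨-, h'⟩
      · exact Finset.mem_insert_self _ _
      · exact Finset.mem_insert_of_mem (h.target_mem _ _ _ h')
      · exact Finset.mem_insert_of_mem (h.target_mem _ _ _ h')
    · intro x k y hxy
      rcases key x k y hxy with ⟨-, -, rfl⟩ | ⟨-, h'⟩ | ⟨-, h'⟩
      · exact (hne _ h.root_mem).symm
      · exact h.ne_root _ _ _ h'
      · exact h.ne_root _ _ _ h'
    · obtain ⟨r, hr⟩ := h.exists_rank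
      -- The copy gets the rank of the original.
      refine ⟨fun a => if a = n₂ then r n else r a, fun x k y hxy => ?_⟩
      dsimp only
      rcases key x k y hxy with ⟨rfl, -, rfl⟩ | ⟨rfl, h'⟩ | ⟨-, h'⟩
      · rw [if_pos rfl, if_neg (hne _ hm.1)]
        exact hr _ _ _ hm
      · rw [if_pos rfl, if_neg (hne _ (h.target_mem _ _ _ h'))]
        exact hr _ _ _ h'
      · rw [if_neg (hne _ h'.1), if_neg (hne _ (h.target_mem _ _ _ h'))]
        exact hr _ _ _ h'
    · intro a ha e he
      simp only [replicate] at ha he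
      rcases Finset.mem_insert.1 ha with rfl | ha
      · rw [if_pos rfl] at he
        exact h.pos_kbo n hn e he
      · rw [if_neg (hne a ha)] at he
        exact h.pos_kbo a ha e he
  refine ⟨hpre, rfl, rfl, Finset.subset_insert _ _, ?_, ?_, ?_⟩
  · intro y hy hny x k hxy
    rcases key x k y hxy with ⟨-, -, rfl⟩ | ⟨-, h'⟩ | ⟨-, h'⟩
    · exact absurd hy hn₂
    · exact absurd ⟨_, h'⟩ hny
    · exact h'
  · intro x k y hxy _ hy
    refine replicate_edge_of_ne hn₂ ?_ hxy
    rintro ⟨rfl, rfl⟩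
    exact hy (hxy.2.2.symm.trans hm.2.2)
  · intro σ
    refine h.collect_eq_of_step hpre rfl σ fun a ha hx har ih => ?_
    have hl : (D.replicate m ℓ n n₂).label a = D.label a := if_neg (hne a ha)
    refine collect_eq_of_next (D' := D.replicate m ℓ n n₂) ha (Finset.mem_insert_of_mem ha) hx hx
      hl ?_
    have hs : D.SubstStep ord σ a (D.next a (ord.eval σ (D.label a))) := ⟨ha, hx, rfl⟩
    have hmem := h.next_mem σ ha hx
    rw [hl]
    change _ = collect ord _ σ (if a = m ∧ ord.eval σ (D.label a) = ℓ then n₂ else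
      if a = n₂ then _ else _)
    split_ifs with hc hc'
    · obtain ⟨rfl, rfl⟩ := hc
      rw [hm.2.2] at hs ⊢
      have hl' : (D.replicate a (ord.eval σ (D.label a)) n n₂).label n₂ = D.label n := if_pos rfl
      -- The original `n` in `D` is compared with its copy: labels and targets agree, so the
      -- induction hypothesis is needed at the successor of `n`, two steps below `a`.
      refine collect_eq_of_next hn (Finset.mem_insert_self _ _) hnx (hne _ h.exit_mem).symm hl' ?_
      have hnext : (D.replicate a (ord.eval σ (D.label a)) n n₂).next n₂ (ord.eval σ (D.label n)) =
          D.next n (ord.eval σ (D.label n)) := by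
        simp only [replicate, if_true]
        exact if_neg fun h' => hne a ha h'.1.symm
      rw [hl', hnext]
      exact ih _ (h.next_mem σ hn hnx) (.tail (.single hs) ⟨hn, hnx, rfl⟩)
    · exact absurd hc' (hne a ha)
    · exact ih _ hmem (.single hs)

/-- Replication is not followed by a cleanup, so the absence of orphans is checked directly: `n`
keeps one of its several incoming edges. -/
theorem noOrphan_replicate (ho : D.NoOrphan) {m n n₂ : ℕ}
    {ℓ : Option EdgeLabel} (hm : D.Edge m ℓ n) (hn₂ : n₂ ∉ D.nodes)
    (hin : (D.inEdges n).Nontrivial) : (D.replicate m ℓ n n₂).NoOrphan := by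
  intro a ha har
  rcases Finset.mem_insert.1 ha with rfl | ha
  · exact ⟨(m, ℓ), replicate_edge_self hn₂ hm⟩
  · by_cases han : a = n
    · subst han
      obtain ⟨⟨x, k⟩, hx, hne⟩ := hin.exists_ne (m, ℓ)
      exact ⟨(x, k), replicate_edge_of_ne hn₂ (by rwa [Ne, Prod.mk.injEq] at hne) hx⟩
    · obtain ⟨⟨x, k⟩, hx⟩ := ho a ha har
      refine ⟨(x, k), replicate_edge_of_ne hn₂ ?_ hx⟩
      rintro ⟨rfl, rfl⟩
      exact han (hx.2.2.symm.trans hm.2.2)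

theorem replaceNode_edge {n n' x y : ℕ} {ℓ : Option EdgeLabel}
    (h : (D.replaceNode n n').Edge x ℓ y) : (y = n' ∧ D.Edge x ℓ n) ∨ (y ≠ n ∧ D.Edge x ℓ y) := by
  obtain ⟨h1, h2, h3⟩ := h
  simp only [replaceNode] at h1 h2 h3
  split_ifs at h3 with hc
  · exact .inl ⟨h3.symm, h1, h2, hc⟩
  · exact .inr ⟨h3 ▸ hc, h1, h2, h3⟩

theorem replaceNode_edge_of_ne {n n' x y : ℕ} {ℓ : Option EdgeLabel} (hy : y ≠ n)
    (h : D.Edge x ℓ y) : (D.replaceNode n n').Edge x ℓ y :=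
  ⟨h.1, h.2.1, by simp only [replaceNode]; rw [h.2.2, if_neg hy]⟩

theorem replaceNode_edge_self {n n' x : ℕ} {ℓ : Option EdgeLabel}
    (h : D.Edge x ℓ n) : (D.replaceNode n n').Edge x ℓ n' :=
  ⟨h.1, h.2.1, by simp only [replaceNode]; rw [h.2.2, if_pos rfl]⟩

/-- Covers the LPO transformations that create no comparison: `n` sends every substitution to the
same target `n'`. -/
theorem PreTOD.localChange_replaceNode (h : D.PreTOD ord) {n n' : ℕ} (hadj : D.Adj n n')
    (hf : ∀ σ, D.EvalStep ord σ n n') : LocalChange ord D n (D.replaceNode n n') := by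
  obtain ⟨ℓ, hn⟩ := hadj
  have hpre : (D.replaceNode n n').PreTOD ord := by
    refine ⟨h.root_mem, h.label_root, h.label_exit, ?_, ?_, ?_, h.pos_kbo⟩
    · intro x k y hxy
      rcases replaceNode_edge hxy with ⟨rfl, -⟩ | ⟨-, h'⟩
      · exact h.target_mem _ _ _ hn
      · exact h.target_mem _ _ _ h'
    · intro x k y hxy
      rcases replaceNode_edge hxy with ⟨rfl, -⟩ | ⟨-, h'⟩
      · exact h.ne_root _ _ _ hn
      · exact h.ne_root _ _ _ h'
    · obtain ⟨r, hr⟩ := h.exists_rank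
      refine ⟨r, fun x k y hxy => ?_⟩
      rcases replaceNode_edge hxy with ⟨rfl, h'⟩ | ⟨-, h'⟩
      · exact (hr _ _ _ hn).trans (hr _ _ _ h')
      · exact hr _ _ _ h'
  refine ⟨hpre, rfl, rfl, Finset.Subset.refl _, ?_, ?_, ?_⟩
  · intro y _ hy x k hxy
    rcases replaceNode_edge hxy with ⟨rfl, -⟩ | ⟨-, h'⟩
    · exact absurd ⟨_, hn⟩ hy
    · exact h'
  · intro x k y hxy _ hy
    exact replaceNode_edge_of_ne hy hxy
  · intro σ
    refine h.collect_eq_of_step hpre rfl σ fun a ha hx har ih => ?_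
    refine collect_eq_of_next (D' := D.replaceNode n n') ha ha hx hx rfl ?_
    have hs : D.SubstStep ord σ a (D.next a (ord.eval σ (D.label a))) := ⟨ha, hx, rfl⟩
    have hmem := h.next_mem σ ha hx
    change _ = collect ord _ σ (if D.next a (ord.eval σ (D.label a)) = n then n' else _)
    split_ifs with hc
    · rw [hc] at hs ⊢
      rw [h.collect_evalStep (hf σ)]
      exact ih _ (h.target_mem _ _ _ hn) (.tail (.single hs) (h.substStep_of_evalStep (hf σ)))
    · exact ih _ hmem (.single hs)

/-- The node `n` of `D` is refined to an acyclic subgraph of evaluation nodes: the new nodes `ν i`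
and `n` itself, with edges from `n` to new nodes and from `ν i` to new nodes of greater depth `d`,
and with all other edges leading to targets of edges of `n` in `D`. -/
structure Refines {ι : Type} (ord : TermOrdering L V) (D : Diagram L V) (n : ℕ) (ν : ι → ℕ)
    (d : ι → ℕ) (K : ℕ) (D' : Diagram L V) : Prop where
  ext : D.Extends n ν D'
  isEval : (D.label n).IsEval
  mem : n ∈ D.nodes
  isEval_self : (D'.label n).IsEval
  isEval_new : ∀ i, (D'.label (ν i)).IsEval
  pos_self : ∀ e, D'.label n = .pos e → ord.IsKBO
  pos_new : ∀ i e, D'.label (ν i) = .pos e → ord.IsKBO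
  edge_self : ∀ ℓ ∈ (D'.label n).out, D.Adj n (D'.next n ℓ) ∨ ∃ j, D'.next n ℓ = ν j
  edge_new : ∀ i, ∀ ℓ ∈ (D'.label (ν i)).out,
    D.Adj n (D'.next (ν i) ℓ) ∨ ∃ j, D'.next (ν i) ℓ = ν j ∧ d i < d j
  depth_lt : ∀ i, d i < K
  eval_eq : ∀ σ, Relation.ReflTransGen (D'.EvalStep ord σ) n (D.next n (ord.eval σ (D.label n)))

theorem Refines.edge_cases {ι : Type} {n K : ℕ} {ν d : ι → ℕ} (hR : D.Refines ord n ν d K D')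
    {x y : ℕ} {ℓ : Option EdgeLabel} (hxy : D'.Edge x ℓ y) :
    (x ≠ n ∧ D.Edge x ℓ y) ∨ (x = n ∧ (D.Adj n y ∨ ∃ j, y = ν j)) ∨
      ∃ i, x = ν i ∧ (D.Adj n y ∨ ∃ j, y = ν j ∧ d i < d j) := by
  obtain ⟨hx, hℓ, rfl⟩ := hxy
  by_cases hxn : x = n
  · subst hxn
    exact .inr (.inl ⟨rfl, hR.edge_self ℓ hℓ⟩)
  · rcases (hR.ext.nodes_eq x).1 hx with hx | ⟨i, rfl⟩
    · rw [hR.ext.label_eq x hx hxn] at hℓ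
      exact .inl ⟨hxn, hx, hℓ, by rw [hR.ext.next_eq x hx hxn]⟩
    · exact .inr (.inr ⟨i, rfl, hR.edge_new i ℓ hℓ⟩)

-- A run that enters `n` leaves the new subgraph at the node to which `n` sent it before, and
-- elsewhere nothing changes. For acyclicity the new nodes need ranks strictly between that of `n`
-- and those of its old targets.
open Classical in
theorem Refines.localChange {ι : Type} {n K : ℕ} {ν d : ι → ℕ} (hR : D.Refines ord n ν d K D')
    (h : D.PreTOD ord) : LocalChange ord D n D' := by
  have hE := hR.ext
  have hsub : D.nodes ⊆ D'.nodes := fun a ha => (hE.nodes_eq a).2 (.inl ha)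
  have hnew : ∀ i, ν i ∈ D'.nodes := fun i => (hE.nodes_eq _).2 (.inr ⟨i, rfl⟩)
  have hne : ∀ a ∈ D.nodes, ∀ i, a ≠ ν i := by rintro a ha i rfl; exact hE.fresh i ha
  have hadj : ∀ y, D.Adj n y → y ∈ D.nodes := fun y ⟨ℓ, hy⟩ => h.target_mem _ _ _ hy
  have hsrc : ∀ a ∈ D'.nodes, (a ∈ D.nodes ∧ a ≠ n) ∨ a = n ∨ ∃ i, a = ν i := by
    intro a ha
    by_cases han : a = n
    · exact .inr (.inl han)
    · rcases (hE.nodes_eq a).1 ha with h' | ⟨i, rfl⟩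
      · exact .inl ⟨h', han⟩
      · exact .inr (.inr ⟨i, rfl⟩)
  have hpre : D'.PreTOD ord := by
    refine ⟨?_, ?_, ?_, ?_, ?_, ?_, ?_⟩
    · rw [hE.root_eq]; exact hsub h.root_mem
    · intro a ha
      rw [hE.root_eq]
      rcases hsrc a ha with ⟨h1, h2⟩ | rfl | ⟨i, rfl⟩
      · rw [hE.label_eq a h1 h2, h.label_root a h1]
      · refine iff_of_false (fun h' => ?_) (h.ne_root_of_isEval hR.mem hR.isEval)
        have := hR.isEval_self
        rw [h'] at this
        exact this
      · refine iff_of_false (fun h' => ?_) (hne _ h.root_mem i).symm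
        have := hR.isEval_new i
        rw [h'] at this
        exact this
    · intro a ha
      rw [hE.exit_eq]
      rcases hsrc a ha with ⟨h1, h2⟩ | rfl | ⟨i, rfl⟩
      · rw [hE.label_eq a h1 h2, h.label_exit a h1]
      · refine iff_of_false (fun h' => ?_) (h.ne_exit_of_isEval hR.mem hR.isEval)
        have := hR.isEval_self
        rw [h'] at this
        exact this
      · refine iff_of_false (fun h' => ?_) (hne _ h.exit_mem i).symm
        have := hR.isEval_new i
        rw [h'] at this
        exact this
    · intro x k y hxy
      rcases hR.edge_cases hxy with ⟨-, h'⟩ | ⟨-, h' | ⟨j, rfl⟩⟩ | ⟨i, -, h' | ⟨j, rfl, -⟩⟩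
      · exact hsub (h.target_mem _ _ _ h')
      · exact hsub (hadj _ h')
      · exact hnew j
      · exact hsub (hadj _ h')
      · exact hnew j
    · intro x k y hxy
      rw [hE.root_eq]
      rcases hR.edge_cases hxy with ⟨-, h'⟩ | ⟨-, ⟨_, h'⟩ | ⟨j, rfl⟩⟩ |
        ⟨i, -, ⟨_, h'⟩ | ⟨j, rfl, -⟩⟩
      · exact h.ne_root _ _ _ h'
      · exact h.ne_root _ _ _ h'
      · exact (hne _ h.root_mem j).symm
      · exact h.ne_root _ _ _ h'
      · exact (hne _ h.root_mem j).symm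
    · obtain ⟨r, hr⟩ := h.exists_rank
      -- Scaling the old ranks by `K + 1` opens gaps. A new node of depth `d < K` is placed `d + 1`
      -- below `n`, hence above every old target of `n`, which is at least `K + 1` below.
      set r' : ℕ → ℕ := fun a => if ha : ∃ i, a = ν i then (K + 1) * r n - (d ha.choose + 1)
        else (K + 1) * r a
      have hold : ∀ a ∈ D.nodes, r' a = (K + 1) * r a := fun a ha =>
        dif_neg fun ⟨i, hi⟩ => hne a ha i hi
      have hnu : ∀ i, r' (ν i) = (K + 1) * r n - (d i + 1) := by
        intro i
        have hi : ∃ j, ν i = ν j := ⟨i, rfl⟩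
        have hi' : hi.choose = i := (hE.injective hi.choose_spec).symm
        simp only [r']
        rw [dif_pos hi, hi']
      -- The subtraction in `r'` is truncated, so `r n` must be positive; it is, because `n` has an
      -- outgoing edge.
      have hpos : K + 1 ≤ (K + 1) * r n := by
        exact Nat.le_mul_of_pos_right _ (Nat.zero_lt_of_lt (hr _ _ _
          (h.edge_eval (idSubst L V) hR.mem (h.ne_exit_of_isEval hR.mem hR.isEval))))
      have hmul : ∀ x y, r y < r x → (K + 1) * r y + (K + 1) ≤ (K + 1) * r x := by
        intro x y hxy
        rw [← Nat.mul_succ]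
        exact Nat.mul_le_mul_left _ hxy
      refine ⟨r', fun x k y hxy => ?_⟩
      rcases hR.edge_cases hxy with ⟨-, h'⟩ | ⟨rfl, ⟨_, h'⟩ | ⟨j, rfl⟩⟩ |
        ⟨i, rfl, ⟨_, h'⟩ | ⟨j, rfl, hij⟩⟩
      · rw [hold _ h'.1, hold _ (h.target_mem _ _ _ h')]
        have := hmul _ _ (hr _ _ _ h')
        omega
      · rw [hold _ h'.1, hold _ (h.target_mem _ _ _ h')]
        have := hmul _ _ (hr _ _ _ h')
        omega
      · rw [hold _ hR.mem, hnu]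
        omega
      · rw [hold _ (h.target_mem _ _ _ h'), hnu]
        have := hmul _ _ (hr _ _ _ h')
        have := hR.depth_lt i
        omega
      · rw [hnu, hnu]
        have := hR.depth_lt i
        have := hR.depth_lt j
        omega
    · intro a ha e he
      rcases hsrc a ha with ⟨h1, h2⟩ | rfl | ⟨i, rfl⟩
      · rw [hE.label_eq a h1 h2] at he
        exact h.pos_kbo a h1 e he
      · exact hR.pos_self e he
      · exact hR.pos_new i e he
  refine ⟨hpre, hE.root_eq, hE.exit_eq, hsub, ?_, ?_, ?_⟩
  · intro y hy hny x k hxy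
    rcases hR.edge_cases hxy with ⟨-, h'⟩ | ⟨-, h' | ⟨j, rfl⟩⟩ | ⟨i, -, h' | ⟨j, rfl, -⟩⟩
    · exact h'
    · exact absurd h' hny
    · exact absurd hy (hE.fresh j)
    · exact absurd h' hny
    · exact absurd hy (hE.fresh j)
  · rintro x k y ⟨hx, hk, rfl⟩ hxn _
    exact ⟨hsub hx, by rwa [hE.label_eq x hx hxn], by rw [hE.next_eq x hx hxn]⟩
  · intro σ
    refine h.collect_eq_of_step hpre hE.exit_eq σ fun a ha hx har ih => ?_
    have hs : D.SubstStep ord σ a (D.next a (ord.eval σ (D.label a))) := ⟨ha, hx, rfl⟩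
    have hmem := h.next_mem σ ha hx
    by_cases han : a = n
    · subst han
      rw [h.collect_evalStep ⟨ha, hR.isEval, rfl⟩, hpre.collect_evalSteps (hR.eval_eq σ)]
      exact ih _ hmem (.single hs)
    · have hl := hE.label_eq a ha han
      refine collect_eq_of_next ha (hsub ha) hx (by rwa [hE.exit_eq]) hl ?_
      rw [hl, hE.next_eq a ha han]
      exact ih _ hmem (.single hs)

/-- `LocalChange` leaves open what becomes of edges into `n`. In a refinement they stay, so that the
path followed by the retrieval still ends at `n`. -/
theorem Refines.edge_keep_self {ι : Type} {n K : ℕ} {ν d : ι → ℕ}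
    (hR : D.Refines ord n ν d K D') {x : ℕ} {ℓ : Option EdgeLabel} (hx : D.Edge x ℓ n)
    (hxn : x ≠ n) : D'.Edge x ℓ n := by
  obtain ⟨hx, hk, hn⟩ := hx
  exact ⟨(hR.ext.nodes_eq x).2 (.inl hx), by rwa [hR.ext.label_eq x hx hxn],
    by rw [hR.ext.next_eq x hx hxn, hn]⟩

end LocalChange

/-! ### Correctness of the KBO and LPO transformations. -/

section Specific

variable {L : FirstOrder.Language.{u, v}} {V : Type w} {ord : TermOrdering L V}
  {D D' : Diagram L V}

theorem nodeAt_of_lt {k : ℕ} (ν : Fin k → ℕ) (d : ℕ) (i : Fin k) : nodeAt ν d i = ν i :=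
  dif_pos i.2

theorem nodeAt_of_le {k : ℕ} (ν : Fin k → ℕ) (d : ℕ) {j : ℕ} (hj : k ≤ j) : nodeAt ν d j = d :=
  dif_neg hj.not_gt

theorem nodeAt_cons_zero {k : ℕ} (n : ℕ) (ν : Fin k → ℕ) (d : ℕ) :
    nodeAt (Fin.cons n ν : Fin (k + 1) → ℕ) d 0 = n :=
  nodeAt_of_lt (Fin.cons n ν : Fin (k + 1) → ℕ) d 0

theorem nodeAt_cons_succ {k : ℕ} (n : ℕ) (ν : Fin k → ℕ) (d j : ℕ) :
    nodeAt (Fin.cons n ν : Fin (k + 1) → ℕ) d (j + 1) = nodeAt ν d j := by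
  by_cases hj : j < k
  · exact (nodeAt_of_lt (Fin.cons n ν : Fin (k + 1) → ℕ) d (Fin.succ ⟨j, hj⟩)).trans
      ((Fin.cons_succ (α := fun _ => ℕ) n ν ⟨j, hj⟩).trans (nodeAt_of_lt ν d ⟨j, hj⟩).symm)
  · rw [nodeAt_of_le _ _ (by omega), nodeAt_of_le _ _ (by omega)]

theorem nodeAt_cases {k : ℕ} (ν : Fin k → ℕ) (d j : ℕ) :
    nodeAt ν d j = d ∨ ∃ i : Fin k, i.1 = j ∧ nodeAt ν d j = ν i := by
  by_cases hj : j < k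
  · exact .inr ⟨⟨j, hj⟩, rfl, nodeAt_of_lt ν d ⟨j, hj⟩⟩
  · exact .inl (nodeAt_of_le ν d (by omega))

/-- Walking along a chain of nodes from position `a` on as long as the positions are good. -/
theorem chain_reaches {R : ℕ → ℕ → Prop} {k : ℕ} {ν : Fin k → ℕ} {d T : ℕ} (good : Fin k → Prop)
    (a : ℕ)
    (hgood : ∀ i : Fin k, a ≤ i → good i → R (ν i) (nodeAt ν d (i + 1)))
    (hbad : ∀ i : Fin k, a ≤ i → (∀ j : Fin k, a ≤ j → j < i → good j) → ¬ good i →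
      Relation.ReflTransGen R (ν i) T)
    (hend : (∀ i : Fin k, a ≤ i → good i) → Relation.ReflTransGen R d T) :
    Relation.ReflTransGen R (nodeAt ν d a) T := by
  suffices H : ∀ b, a ≤ b → (∀ j : Fin k, a ≤ j → j < b → good j) →
      Relation.ReflTransGen R (nodeAt ν d b) T from
    H a le_rfl fun j h h' => absurd h h'.not_ge
  intro b
  induction hk : k - b using Nat.strong_induction_on generalizing b with
  | _ m ih =>
    intro hab hb
    by_cases hbk : b < k
    · have hν : nodeAt ν d b = ν ⟨b, hbk⟩ := nodeAt_of_lt ν d ⟨b, hbk⟩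
      rw [hν]
      by_cases hg : good ⟨b, hbk⟩
      · refine .head (hgood ⟨b, hbk⟩ hab hg) (ih (k - (b + 1)) (by omega) (b + 1) rfl
          (by omega) fun j hj hjb => ?_)
        rcases Nat.lt_succ_iff_lt_or_eq.1 hjb with h | h
        · exact hb j hj h
        · have : j = ⟨b, hbk⟩ := Fin.ext h
          rwa [this]
      · exact hbad ⟨b, hbk⟩ hab (fun j hj hjb => hb j hj hjb) hg
    · rw [nodeAt_of_le _ _ (by omega)]
      exact hend fun i hi => hb i hi (by omega)

section Nodes

variable {n a b c : ℕ} {s t : L.Term V} {e : LinExpr V} {σ : Subst L V}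

theorem IsCmp.isEval (h : D.IsCmp n s t a b c) : (D.label n).IsEval := by
  rw [h.2.1]; trivial

theorem IsCmp.pos (h : D.IsCmp n s t a b c) : ∀ e, D.label n = .pos e → ord.IsKBO := by
  intro e he
  rw [h.2.1] at he
  cases he

theorem IsCmp.next_eq (h : D.IsCmp n s t a b c) :
    D.next n (ord.eval σ (D.label n)) = D.next n (some (ord.evalCmp σ s t)) := by
  rw [h.2.1]; rfl

theorem IsCmp.next_gt (h : D.IsCmp n s t a b c) (h' : ord.evalCmp σ s t = .gt) :
    D.next n (ord.eval σ (D.label n)) = a := by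
  rw [h.next_eq, h', h.2.2.1]

theorem IsCmp.next_of_eq (h : D.IsCmp n s t a b c) (h' : ord.evalCmp σ s t = .eq) :
    D.next n (ord.eval σ (D.label n)) = b := by
  rw [h.next_eq, h', h.2.2.2.1]

theorem IsCmp.next_ngeq (h : D.IsCmp n s t a b c) (h' : ord.evalCmp σ s t = .ngeq) :
    D.next n (ord.eval σ (D.label n)) = c := by
  rw [h.next_eq, h', h.2.2.2.2]

theorem IsCmp.step_gt (h : D.IsCmp n s t a b c) (h' : ord.evalCmp σ s t = .gt) :
    D.EvalStep ord σ n a := ⟨h.1, h.isEval, h.next_gt h'⟩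

theorem IsCmp.step_eq (h : D.IsCmp n s t a b c) (h' : ord.evalCmp σ s t = .eq) :
    D.EvalStep ord σ n b := ⟨h.1, h.isEval, h.next_of_eq h'⟩

theorem IsCmp.step_ngeq (h : D.IsCmp n s t a b c) (h' : ord.evalCmp σ s t = .ngeq) :
    D.EvalStep ord σ n c := ⟨h.1, h.isEval, h.next_ngeq h'⟩

/-- A comparison node whose `=` and `≱` edges have the same target. -/
theorem IsCmp.step_not_gt (h : D.IsCmp n s t a b b) (h' : ¬ ord.gt (σ.app s) (σ.app t)) :
    D.EvalStep ord σ n b := by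
  rcases evalCmp_cases ord σ s t with h1 | h1 | h1
  · exact absurd (evalCmp_eq_gt.1 h1) h'
  · exact h.step_eq h1
  · exact h.step_ngeq h1

/-- A comparison node whose `>` and `=` edges have the same target. -/
theorem IsCmp.step_ge (h : D.IsCmp n s t a a c)
    (h' : ord.gt (σ.app s) (σ.app t) ∨ σ.app s = σ.app t) : D.EvalStep ord σ n a := by
  rcases evalCmp_cases ord σ s t with h1 | h1 | h1
  · exact h.step_gt h1
  · exact h.step_eq h1
  · exact absurd h' (not_or.2 (evalCmp_eq_ngeq.1 h1))

theorem IsCmp.step_not_ge (h : D.IsCmp n s t a b c)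
    (h' : ¬ (ord.gt (σ.app s) (σ.app t) ∨ σ.app s = σ.app t)) : D.EvalStep ord σ n c :=
  h.step_ngeq (evalCmp_eq_ngeq.2 (not_or.1 h'))

theorem IsCmp.forall_out (h : D.IsCmp n s t a b c) {P : ℕ → Prop} (ha : P a) (hb : P b)
    (hc : P c) : ∀ ℓ ∈ (D.label n).out, P (D.next n ℓ) := by
  intro ℓ hℓ
  rw [h.2.1] at hℓ
  obtain ⟨-, -, rfl, rfl, rfl⟩ := h
  rcases hℓ with rfl | rfl | rfl <;> assumption

theorem IsCmp.adj (h : D.IsCmp n s t a b c) : D.Adj n a ∧ D.Adj n b ∧ D.Adj n c := by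
  obtain ⟨h0, hl, h1, h2, h3⟩ := h
  refine ⟨⟨_, h0, ?_, h1⟩, ⟨_, h0, ?_, h2⟩, ⟨_, h0, ?_, h3⟩⟩ <;> rw [hl] <;>
    simp [NodeLabel.out]

theorem IsPos.isEval (h : D.IsPos n e a b c) : (D.label n).IsEval := by
  rw [h.2.1]; trivial

theorem IsPos.next_eq (h : D.IsPos n e a b c) :
    D.next n (ord.eval σ (D.label n)) = D.next n (some (ord.evalPos σ e)) := by
  rw [h.2.1]; rfl

theorem IsPos.step_gt (h : D.IsPos n e a b c) (h' : ord.evalPos σ e = .gt) :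
    D.EvalStep ord σ n a := ⟨h.1, h.isEval, by rw [h.next_eq, h', h.2.2.1]⟩

theorem IsPos.step_geq (h : D.IsPos n e a b c) (h' : ord.evalPos σ e = .geq) :
    D.EvalStep ord σ n b := ⟨h.1, h.isEval, by rw [h.next_eq, h', h.2.2.2.1]⟩

theorem IsPos.step_ngeq (h : D.IsPos n e a b c) (h' : ord.evalPos σ e = .ngeq) :
    D.EvalStep ord σ n c := ⟨h.1, h.isEval, by rw [h.next_eq, h', h.2.2.2.2]⟩

theorem IsPos.forall_out (h : D.IsPos n e a b c) {P : ℕ → Prop} (ha : P a) (hb : P b)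
    (hc : P c) : ∀ ℓ ∈ (D.label n).out, P (D.next n ℓ) := by
  intro ℓ hℓ
  rw [h.2.1] at hℓ
  obtain ⟨-, -, rfl, rfl, rfl⟩ := h
  rcases hℓ with rfl | rfl | rfl <;> assumption

end Nodes

theorem symb_eq_of_func_eq {k m : ℕ} {f : L.Functions k} {g : L.Functions m}
    {ss : Fin k → L.Term V} {ts : Fin m → L.Term V} (h : Term.func f ss = Term.func g ts) :
    (⟨k, f⟩ : Symb L) = ⟨m, g⟩ := by
  cases h
  rfl

theorem args_eq_of_func_eq {k : ℕ} {f : L.Functions k} {ss ts : Fin k → L.Term V}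
    (h : Term.func f ss = Term.func f ts) : ss = ts := by
  cases h
  rfl

/-- Walking along a chain of comparison nodes `ν i`, labelled `sᵢ ? tᵢ`, that are left along their
`=` edges to the next node of the chain. -/
theorem lexChain_reaches {ord : TermOrdering L V} {σ : Subst L V} {k : ℕ} {ν : Fin k → ℕ}
    {ss ts : Fin k → L.Term V} {a b c T : ℕ}
    (hν : ∀ i : Fin k, D.IsCmp (ν i) (ss i) (ts i) a (nodeAt ν b (i + 1)) c)
    (hgt : ∀ i : Fin k, (∀ j < i, ¬ ord.gt (σ.app (ss j)) (σ.app (ts j)) ∧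
      σ.app (ss j) = σ.app (ts j)) → ord.gt (σ.app (ss i)) (σ.app (ts i)) → T = a)
    (hngeq : ∀ i : Fin k, (∀ j < i, ¬ ord.gt (σ.app (ss j)) (σ.app (ts j)) ∧
      σ.app (ss j) = σ.app (ts j)) → ¬ ord.gt (σ.app (ss i)) (σ.app (ts i)) →
      σ.app (ss i) ≠ σ.app (ts i) → T = c)
    (heq : (∀ j, ¬ ord.gt (σ.app (ss j)) (σ.app (ts j)) ∧
      σ.app (ss j) = σ.app (ts j)) → T = b) :
    Relation.ReflTransGen (D.EvalStep ord σ) (nodeAt ν b 0) T := by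
  refine chain_reaches (fun j => ¬ ord.gt (σ.app (ss j)) (σ.app (ts j)) ∧
      σ.app (ss j) = σ.app (ts j)) 0 ?_ ?_ ?_
  · intro i _ hi
    exact (hν i).step_eq (evalCmp_eq_eq.2 hi)
  · intro i _ hj hi
    have hj' := fun j => hj j (Nat.zero_le _)
    by_cases h1 : ord.gt (σ.app (ss i)) (σ.app (ts i))
    · rw [hgt i hj' h1]
      exact .single ((hν i).step_gt (evalCmp_eq_gt.2 h1))
    · have h2 : σ.app (ss i) ≠ σ.app (ts i) := fun h2 => hi ⟨h1, h2⟩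
      rw [hngeq i hj' h1 h2]
      exact .single ((hν i).step_ngeq (evalCmp_eq_ngeq.2 ⟨h1, h2⟩))
  · intro h
    rw [heq fun j => h j (Nat.zero_le _)]

/-! ### The KBO transformations. -/

section KBO

variable {prec : Symb L → Symb L → Prop} {hprec : IsStrictTotalOrder (Symb L) prec}
  {wt : Symb L → ℕ}

/-- The three values of the weight comparison of a KBO. -/
theorem IsPos.kbo_cases {n a b c T : ℕ} {s t : L.Term V} {σ : Subst L V}
    (h : D.IsPos n (weight wt s - weight wt t) a b c)
    (hgt : LinPos wt (weight wt (σ.app s) - weight wt (σ.app t)) → T = a)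
    (hgeq : LinNonneg wt (weight wt (σ.app s) - weight wt (σ.app t)) →
      ¬ LinPos wt (weight wt (σ.app s) - weight wt (σ.app t)) →
      Relation.ReflTransGen (D.EvalStep (.kbo prec hprec wt) σ) b T)
    (hngeq : ¬ LinNonneg wt (weight wt (σ.app s) - weight wt (σ.app t)) → T = c) :
    Relation.ReflTransGen (D.EvalStep (.kbo prec hprec wt) σ) n T := by
  by_cases h1 : LinPos wt (weight wt (σ.app s) - weight wt (σ.app t))
  · rw [hgt h1]
    exact .single (h.step_gt (evalPos_weight_eq_gt.2 h1))
  by_cases h2 : LinNonneg wt (weight wt (σ.app s) - weight wt (σ.app t))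
  · exact .head (h.step_geq (evalPos_weight_eq_geq.2 ⟨h1, h2⟩)) (hgeq h2 h1)
  · rw [hngeq h2]
    exact .single (h.step_ngeq (evalPos_weight_eq_ngeq.2 h2))

/-- The positivity check decides (K1) and the common condition of (K2) and (K3). On its `≥` edge
(K1) fails, and the precedence or the chain of argument comparisons decides alone. -/
theorem KBOReplace.exists_refines {n : ℕ} (h : KBOReplace prec wt D n D') :
    ∃ (ι : Type) (ν d : ι → ℕ) (K : ℕ), D.Refines (.kbo prec hprec wt) n ν d K D' := by
  have hirr := hprec.irrefl
  cases h with
  | @greater k m f g ss ts n₁ n₂ n₃ hn hfg hE hp =>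
    obtain ⟨a₁, -, a₃⟩ := hn.adj
    refine ⟨Fin 0, Fin.elim0, Fin.elim0, 0, hE, hn.isEval, hn.1, hp.isEval, nofun,
      fun _ _ => trivial, nofun, 
      hp.forall_out (P := fun y => D.Adj n y ∨ ∃ j, y = Fin.elim0 j) (.inl a₁) (.inl a₁) (.inl a₃),
      nofun, nofun, ?_⟩
    intro σ
    refine hp.kbo_cases (fun h1 => ?_) (fun h1 _ => ?_) (fun h1 => ?_)
    · exact hn.next_gt (evalCmp_eq_gt.2 (KBO.weight_gt h1))
    · rw [hn.next_gt (ord := .kbo prec hprec wt) (σ := σ) (evalCmp_eq_gt.2 (KBO.prec h1 hfg))]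
    · refine hn.next_ngeq (evalCmp_eq_ngeq.2 ⟨fun h2 => ?_, fun h2 => ?_⟩)
      · rcases KBO.cases_func h2 with h2 | h2
        · exact h1 (linNonneg_of_linPos h2)
        · exact h1 h2.1
      · have := symb_eq_of_func_eq h2
        rw [this] at hfg
        exact hirr _ hfg
  | @less k m f g ss ts n₁ n₂ n₃ hn hfg hE hp =>
    obtain ⟨a₁, -, a₃⟩ := hn.adj
    refine ⟨Fin 0, Fin.elim0, Fin.elim0, 0, hE, hn.isEval, hn.1, hp.isEval, nofun,
      fun _ _ => trivial, nofun, 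
      hp.forall_out (P := fun y => D.Adj n y ∨ ∃ j, y = Fin.elim0 j) (.inl a₁) (.inl a₃) (.inl a₃),
      nofun, nofun, ?_⟩
    intro σ
    have hne : ∀ h : (⟨k, f⟩ : Symb L) = ⟨m, g⟩, False := by
      intro h
      rw [h] at hfg
      exact hirr _ hfg
    -- With `g ≫ f` only (K1) can give `s ≻ t`, and equality is excluded by the head symbols; so
    -- both remaining edges may lead to `n₃`.
    have key : ¬ LinPos wt (weight wt (σ.app (Term.func f ss)) -
        weight wt (σ.app (Term.func g ts))) →
        D.next n ((TermOrdering.kbo prec hprec wt).eval σ (D.label n)) = n₃ := by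
      intro h1
      refine hn.next_ngeq (evalCmp_eq_ngeq.2 ⟨fun h2 => ?_, fun h2 => hne (symb_eq_of_func_eq h2)⟩)
      rcases KBO.cases_func h2 with h2 | ⟨-, h2 | h2⟩
      · exact h1 h2
      · exact hirr _ (hprec.trans _ _ _ h2 hfg)
      · exact hne h2
    refine hp.kbo_cases (fun h1 => ?_) (fun _ h1 => ?_)
      (fun h1 => key fun h2 => h1 (linNonneg_of_linPos h2))
    · exact hn.next_gt (evalCmp_eq_gt.2 (KBO.weight_gt h1))
    · rw [key h1]
  | @same k f ss ts n₁ n₂ n₃ ν hn hE hp hν =>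
    obtain ⟨a₁, a₂, a₃⟩ := hn.adj
    refine ⟨Fin k, ν, fun i => i, k, hE, hn.isEval, hn.1, hp.isEval, fun i => (hν i).isEval,
      fun _ _ => trivial, fun _ _ _ => trivial,
      hp.forall_out (P := fun y => D.Adj n y ∨ ∃ j, y = ν j) (.inl a₁) ?_ (.inl a₃),
      fun i => (hν i).forall_out (P := fun y => D.Adj n y ∨ ∃ j, y = ν j ∧ i.1 < j.1)
        (.inl a₁) ?_ (.inl a₃), fun i => i.2, ?_⟩
    · rcases nodeAt_cases ν n₂ 0 with h | ⟨j, -, h⟩ <;> rw [h]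
      · exact .inl a₂
      · exact .inr ⟨j, rfl⟩
    · rcases nodeAt_cases ν n₂ (i + 1) with h | ⟨j, hj, h⟩ <;> rw [h]
      · exact .inl a₂
      · exact .inr ⟨j, rfl, by omega⟩
    intro σ
    refine hp.kbo_cases (fun h1 => ?_) (fun h1 h1' => ?_) (fun h1 => ?_)
    · exact hn.next_gt (evalCmp_eq_gt.2 (KBO.weight_gt h1))
    · refine lexChain_reaches hν (fun i hj hi => ?_) (fun i hj hi hi' => ?_) (fun hj => ?_)
      · exact hn.next_gt (evalCmp_eq_gt.2 (KBO.lex i h1 hi fun j hji => (hj j hji).2))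
      · refine hn.next_ngeq (evalCmp_eq_ngeq.2 ⟨fun h2 => ?_, fun h2 => ?_⟩)
        · rcases KBO.cases_same hprec h2 with h2 | ⟨i', h2, h3⟩
          · exact h1' h2
          -- Position `i` is the first at which the arguments differ, and it is not greater. A
          -- witness `i'` of (K3) can lie neither after it, at it, nor before it.
          · rcases lt_trichotomy i i' with h | rfl | h
            · exact hi' (h3 i h)
            · exact hi h2
            · exact (hj i' h).1 h2
        · exact hi' (congrFun (args_eq_of_func_eq h2) i)
      · refine hn.next_of_eq (evalCmp_eq_eq.2 ⟨fun h2 => ?_, ?_⟩)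
        · rcases KBO.cases_same hprec h2 with h2 | ⟨i', h2, h3⟩
          · exact h1' h2
          · exact (hj i').1 h2
        · rw [Subst.app_func, Subst.app_func]
          congr 1
          exact funext fun j => (hj j).2
    · refine hn.next_ngeq (evalCmp_eq_ngeq.2 ⟨fun h2 => ?_, fun h2 => h1 ?_⟩)
      · rcases KBO.cases_func h2 with h2 | h2
        · exact h1 (linNonneg_of_linPos h2)
        · exact h1 h2.1
      -- Equal terms have weight difference `0`, which would be `≳ 0`.
      · rw [h2, sub_self]
        exact linNonneg_zero wt

end KBO

/-! ### The LPO transformations. -/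

section LPO

variable {prec : Symb L → Symb L → Prop} {hprec : IsStrictTotalOrder (Symb L) prec}

/-- If some `s_j` with `j ≤ i` were at least `t`, it would be greater than the argument `t_j`, which
is excluded. So after the first difference `i` only later arguments have to be compared with `t`;
this justifies starting the right column beyond `i`. -/
theorem not_lpo_of_last_args {prec : Symb L → Symb L → Prop}
    (hprec : IsStrictTotalOrder (Symb L) prec) {k : ℕ} {f : L.Functions k}
    {ss ts : Fin k → L.Term V} {i : Fin k} (hj : ∀ j < i, ¬ LPO prec (ss j) (ts j))
    (hi : ¬ LPO prec (ss i) (ts i)) (hne : ss i ≠ ts i)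
    (hlast : ∀ j, i < j → ¬ (LPO prec (ss j) (Term.func f ts) ∨ ss j = Term.func f ts)) :
    ¬ LPO prec (Term.func f ss) (Term.func f ts) := by
  intro h
  rcases LPO.cases_same hprec h with ⟨j, h1, h2⟩ | ⟨j, h1⟩
  · rcases lt_trichotomy i j with hij | rfl | hij
    · exact hne (h1 i hij)
    · exact hi h2
    · exact hj j hij h2
  · rcases lt_trichotomy i j with hij | rfl | hij
    · exact hlast j hij h1
    · exact hi (LPO.arg_of_ge h1 i)
    · exact hj j hij (LPO.arg_of_ge h1 j)

theorem not_lpo_of_all_args {prec : Symb L → Symb L → Prop}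
    (hprec : IsStrictTotalOrder (Symb L) prec) {k : ℕ} {f : L.Functions k}
    {ss ts : Fin k → L.Term V} (hj : ∀ j, ¬ LPO prec (ss j) (ts j)) :
    ¬ LPO prec (Term.func f ss) (Term.func f ts) := by
  intro h
  rcases LPO.cases_same hprec h with ⟨j, -, h1⟩ | ⟨j, h1⟩
  · exact hj j h1
  · exact hj j (LPO.arg_of_ge h1 j)

/-- When `g ≫ f`, the lexicographic and precedence clauses are impossible, and only the subterm
clauses remain. -/
theorem ge_arg_of_lpo_of_prec {prec : Symb L → Symb L → Prop}
    (hprec : IsStrictTotalOrder (Symb L) prec) {k m : ℕ} {f : L.Functions k}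
    {g : L.Functions m} {ss : Fin k → L.Term V} {ts : Fin m → L.Term V}
    (hfg : prec ⟨m, g⟩ ⟨k, f⟩) (h : LPO prec (Term.func f ss) (Term.func g ts)) :
    ∃ i, LPO prec (ss i) (Term.func g ts) ∨ ss i = Term.func g ts := by
  rcases LPO.cases_func h with h | h | h
  · rw [h] at hfg
    exact absurd hfg (hprec.irrefl _)
  · exact absurd (hprec.trans _ _ _ h hfg) (hprec.irrefl _)
  · exact h

theorem func_ne_of_prec {prec : Symb L → Symb L → Prop}
    (hprec : IsStrictTotalOrder (Symb L) prec) {k m : ℕ} {f : L.Functions k}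
    {g : L.Functions m} {ss : Fin k → L.Term V} {ts : Fin m → L.Term V}
    (hfg : prec ⟨k, f⟩ ⟨m, g⟩) : Term.func f ss ≠ Term.func g ts := by
  intro h
  rw [symb_eq_of_func_eq h] at hfg
  exact hprec.irrefl _ hfg

theorem PreTOD.ne_of_edge (h : D.PreTOD ord) {m n : ℕ} {ℓ : Option EdgeLabel}
    (he : D.Edge m ℓ n) : m ≠ n := by
  obtain ⟨r, hr⟩ := h.exists_rank
  rintro rfl
  exact (hr _ _ _ he).false

/-- For `f ≫ g`, `s ≻ t` holds exactly if `s ≻ t_i` for all `i`: one direction is the precedence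
clause, the other `LPO.gt_arg`. Equality is impossible, so the first failure leads to `n₃`. -/
theorem refines_lpo_greater {k m n n₁ n₂ n₃ : ℕ} {f : L.Functions k}
    {g : L.Functions (m + 1)} {ss : Fin k → L.Term V} {ts : Fin (m + 1) → L.Term V} {ν : Fin m → ℕ}
    (hn : D.IsCmp n (Term.func f ss) (Term.func g ts) n₁ n₂ n₃)
    (hfg : prec ⟨k, f⟩ ⟨m + 1, g⟩) (hE : D.Extends n ν D')
    (hν : ∀ i : Fin (m + 1), D'.IsCmp ((Fin.cons n ν : Fin (m + 1) → ℕ) i)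
      (Term.func f ss) (ts i) (nodeAt ν n₁ i) n₃ n₃) :
    D.Refines (.lpo prec hprec) n ν (fun i => i) m D' := by
  obtain ⟨a₁, -, a₃⟩ := hn.adj
  have h0 : D'.IsCmp n (Term.func f ss) (ts 0) (nodeAt ν n₁ 0) n₃ n₃ := hν 0
  have hs : ∀ i : Fin m, D'.IsCmp (ν i) (Term.func f ss) (ts i.succ) (nodeAt ν n₁ (i + 1)) n₃ n₃ :=
    fun i => hν i.succ
  refine ⟨hE, hn.isEval, hn.1, h0.isEval, fun i => (hs i).isEval, h0.pos, fun i => (hs i).pos,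
    h0.forall_out (P := fun y => D.Adj n y ∨ ∃ j, y = ν j) ?_ (.inl a₃) (.inl a₃),
    fun i => (hs i).forall_out (P := fun y => D.Adj n y ∨ ∃ j, y = ν j ∧ i.1 < j.1)
      ?_ (.inl a₃) (.inl a₃), fun i => i.2, fun σ => ?_⟩
  · rcases nodeAt_cases ν n₁ 0 with h | ⟨j, -, h⟩ <;> rw [h]
    · exact .inl a₁
    · exact .inr ⟨j, rfl⟩
  · rcases nodeAt_cases ν n₁ (i + 1) with h | ⟨j, hj, h⟩ <;> rw [h]
    · exact .inl a₁
    · exact .inr ⟨j, rfl, by omega⟩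
  have H := chain_reaches (R := D'.EvalStep (.lpo prec hprec) σ)
    (ν := (Fin.cons n ν : Fin (m + 1) → ℕ)) (d := n₁)
    (T := D.next n ((TermOrdering.lpo prec hprec).eval σ (D.label n)))
    (fun i => LPO prec (σ.app (Term.func f ss)) (σ.app (ts i))) 0 ?_ ?_ ?_
  -- The chain consists of `n` for the first argument and of `ν` for the others, so it starts at
  -- `n`.
  · rwa [nodeAt_cons_zero] at H
  · intro i _ hi
    rw [nodeAt_cons_succ]
    exact (hν i).step_gt (evalCmp_eq_gt.2 hi)
  · intro i _ _ hi
    rw [hn.next_ngeq (ord := .lpo prec hprec) (σ := σ)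
          (evalCmp_eq_ngeq.2 ⟨fun h => hi (LPO.gt_arg h i), func_ne_of_prec hprec hfg⟩)]
    exact .single ((hν i).step_not_gt hi)
  · intro hi
    rw [hn.next_gt (ord := .lpo prec hprec) (σ := σ)
          (evalCmp_eq_gt.2 (LPO.prec hfg fun j => hi j (Nat.zero_le _)))]

/-- For `g ≫ f`, `s ≻ t` holds exactly if some `s_i` is greater than or equal to `t`; the chain
leaves for `n₁` at the first such argument. -/
theorem refines_lpo_less {k m n n₁ n₂ n₃ : ℕ} {f : L.Functions (k + 1)}
    {g : L.Functions m} {ss : Fin (k + 1) → L.Term V} {ts : Fin m → L.Term V} {ν : Fin k → ℕ}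
    (hn : D.IsCmp n (Term.func f ss) (Term.func g ts) n₁ n₂ n₃)
    (hfg : prec ⟨m, g⟩ ⟨k + 1, f⟩) (hE : D.Extends n ν D')
    (hν : ∀ i : Fin (k + 1), D'.IsCmp ((Fin.cons n ν : Fin (k + 1) → ℕ) i)
      (ss i) (Term.func g ts) n₁ n₁ (nodeAt ν n₃ i)) :
    D.Refines (.lpo prec hprec) n ν (fun i => i) k D' := by
  obtain ⟨a₁, -, a₃⟩ := hn.adj
  have h0 : D'.IsCmp n (ss 0) (Term.func g ts) n₁ n₁ (nodeAt ν n₃ 0) := hν 0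
  have hs : ∀ i : Fin k, D'.IsCmp (ν i) (ss i.succ) (Term.func g ts) n₁ n₁ (nodeAt ν n₃ (i + 1)) :=
    fun i => hν i.succ
  refine ⟨hE, hn.isEval, hn.1, h0.isEval, fun i => (hs i).isEval, h0.pos, fun i => (hs i).pos,
    h0.forall_out (P := fun y => D.Adj n y ∨ ∃ j, y = ν j) (.inl a₁) (.inl a₁) ?_,
    fun i => (hs i).forall_out (P := fun y => D.Adj n y ∨ ∃ j, y = ν j ∧ i.1 < j.1)
      (.inl a₁) (.inl a₁) ?_, fun i => i.2, fun σ => ?_⟩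
  · rcases nodeAt_cases ν n₃ 0 with h | ⟨j, -, h⟩ <;> rw [h]
    · exact .inl a₃
    · exact .inr ⟨j, rfl⟩
  · rcases nodeAt_cases ν n₃ (i + 1) with h | ⟨j, hj, h⟩ <;> rw [h]
    · exact .inl a₃
    · exact .inr ⟨j, rfl, by omega⟩
  have H := chain_reaches (R := D'.EvalStep (.lpo prec hprec) σ)
    (ν := (Fin.cons n ν : Fin (k + 1) → ℕ)) (d := n₃)
    (T := D.next n ((TermOrdering.lpo prec hprec).eval σ (D.label n)))
    (fun i => ¬ (LPO prec (σ.app (ss i)) (σ.app (Term.func g ts)) ∨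
      σ.app (ss i) = σ.app (Term.func g ts))) 0 ?_ ?_ ?_
  · rwa [nodeAt_cons_zero] at H
  · intro i _ hi
    rw [nodeAt_cons_succ]
    exact (hν i).step_not_ge hi
  · intro i _ _ hi
    rw [hn.next_gt (ord := .lpo prec hprec) (σ := σ)
          (evalCmp_eq_gt.2 (LPO.of_arg (not_not.1 hi)))]
    exact .single ((hν i).step_ge (not_not.1 hi))
  · intro hi
    rw [hn.next_ngeq (ord := .lpo prec hprec) (σ := σ)
          (evalCmp_eq_ngeq.2 ⟨fun h => ?_, (func_ne_of_prec hprec hfg).symm⟩)]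
    obtain ⟨i, h⟩ := ge_arg_of_lpo_of_prec hprec hfg h
    exact hi i (Nat.zero_le _) h

/-- The middle column finds the first position where the instantiated arguments differ. If `s_i ≻
t_i` there, the left column checks that `s` exceeds the later `t_j`; otherwise the right column
looks for a later `s_j` that is at least `t`. The depth is the index within a column, which
increases also when the column changes. -/
theorem refines_lpo_same {k n n₁ n₂ n₃ : ℕ} {f : L.Functions (k + 1)}
    {ss ts : Fin (k + 1) → L.Term V} {left mid right : Fin k → ℕ}
    (hn : D.IsCmp n (Term.func f ss) (Term.func f ts) n₁ n₂ n₃)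
    (hE : D.Extends n (Sum.elim left (Sum.elim mid right)) D')
    (hmid : ∀ i : Fin (k + 1), D'.IsCmp ((Fin.cons n mid : Fin (k + 1) → ℕ) i)
      (ss i) (ts i) (nodeAt left n₁ i) (nodeAt mid n₂ i) (nodeAt right n₃ i))
    (hleft : ∀ i : Fin k, D'.IsCmp (left i) (Term.func f ss) (ts i.succ)
      (nodeAt left n₁ (i + 1)) n₃ n₃)
    (hright : ∀ i : Fin k, D'.IsCmp (right i) (ss i.succ) (Term.func f ts)
      n₁ n₁ (nodeAt right n₃ (i + 1))) :
    D.Refines (.lpo prec hprec) n (Sum.elim left (Sum.elim mid right))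
      (Sum.elim (fun i => i) (Sum.elim (fun i => i) fun i => i)) k D' := by
  obtain ⟨a₁, a₂, a₃⟩ := hn.adj
  have h0 : D'.IsCmp n (ss 0) (ts 0) (nodeAt left n₁ 0) (nodeAt mid n₂ 0) (nodeAt right n₃ 0) :=
    hmid 0
  have hs : ∀ i : Fin k, D'.IsCmp (mid i) (ss i.succ) (ts i.succ) (nodeAt left n₁ (i + 1))
      (nodeAt mid n₂ (i + 1)) (nodeAt right n₃ (i + 1)) := fun i => hmid i.succ
  set ν := Sum.elim left (Sum.elim mid right) with hν
  set d : Fin k ⊕ (Fin k ⊕ Fin k) → ℕ :=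
    Sum.elim (fun i => i) (Sum.elim (fun i => i) fun i => i) with hd
  -- With `b = i + 1` the bound `b ≤ d j` gives the strict increase of depth from index `i`; `b = 0`
  -- serves the edges of `n`.
  have hl : ∀ b : ℕ, D.Adj n (nodeAt left n₁ b) ∨ ∃ j, nodeAt left n₁ b = ν j ∧ b ≤ d j := by
    intro b
    rcases nodeAt_cases left n₁ b with h | ⟨j, hj, h⟩ <;> rw [h]
    · exact .inl a₁
    · exact .inr ⟨.inl j, rfl, hj.ge⟩
  have hm : ∀ b : ℕ, D.Adj n (nodeAt mid n₂ b) ∨ ∃ j, nodeAt mid n₂ b = ν j ∧ b ≤ d j := by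
    intro b
    rcases nodeAt_cases mid n₂ b with h | ⟨j, hj, h⟩ <;> rw [h]
    · exact .inl a₂
    · exact .inr ⟨.inr (.inl j), rfl, hj.ge⟩
  have hr : ∀ b : ℕ, D.Adj n (nodeAt right n₃ b) ∨ ∃ j, nodeAt right n₃ b = ν j ∧ b ≤ d j := by
    intro b
    rcases nodeAt_cases right n₃ b with h | ⟨j, hj, h⟩ <;> rw [h]
    · exact .inl a₃
    · exact .inr ⟨.inr (.inr j), rfl, hj.ge⟩
  have hself : ∀ y, (D.Adj n y ∨ ∃ j, y = ν j ∧ 0 ≤ d j) → D.Adj n y ∨ ∃ j, y = ν j :=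
    fun y h => h.imp_right fun ⟨j, hj⟩ => ⟨j, hj.1⟩
  refine ⟨hE, hn.isEval, hn.1, h0.isEval, ?_, h0.pos, ?_,
    h0.forall_out (P := fun y => D.Adj n y ∨ ∃ j, y = ν j) (hself _ (hl 0)) (hself _ (hm 0))
      (hself _ (hr 0)), ?_, ?_, fun σ => ?_⟩
  · rintro (i | i | i)
    exacts [(hleft i).isEval, (hs i).isEval, (hright i).isEval]
  · rintro (i | i | i)
    exacts [(hleft i).pos, (hs i).pos, (hright i).pos]
  · rintro (i | i | i)
    · exact (hleft i).forall_out (P := fun y => D.Adj n y ∨ ∃ j, y = ν j ∧ i.1 < d j)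
        (hl (i + 1)) (.inl a₃) (.inl a₃)
    · exact (hs i).forall_out (P := fun y => D.Adj n y ∨ ∃ j, y = ν j ∧ i.1 < d j)
        (hl (i + 1)) (hm (i + 1)) (hr (i + 1))
    · exact (hright i).forall_out (P := fun y => D.Adj n y ∨ ∃ j, y = ν j ∧ i.1 < d j)
        (.inl a₁) (.inl a₁) (hr (i + 1))
  · rintro (i | i | i) <;> exact i.2
  -- Column index `j'` stands for argument `j'.succ`, so the arguments after `i` are those with
  -- column index at least `i`.
  have hsucc : ∀ {i j : Fin (k + 1)}, i < j → ∃ j' : Fin k, j = j'.succ ∧ i.1 ≤ j'.1 := by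
    intro i j hij
    obtain ⟨j', rfl⟩ := Fin.exists_succ_eq.2 (Fin.ne_zero_of_lt hij)
    exact ⟨j', rfl, Nat.lt_succ_iff.1 hij⟩
  have H := chain_reaches (R := D'.EvalStep (.lpo prec hprec) σ)
    (ν := (Fin.cons n mid : Fin (k + 1) → ℕ)) (d := n₂)
    (T := D.next n ((TermOrdering.lpo prec hprec).eval σ (D.label n)))
    (fun i => ¬ LPO prec (σ.app (ss i)) (σ.app (ts i)) ∧ σ.app (ss i) = σ.app (ts i)) 0 ?_ ?_ ?_
  · rwa [nodeAt_cons_zero] at H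
  · intro i _ hi
    rw [nodeAt_cons_succ]
    exact (hmid i).step_eq (evalCmp_eq_eq.2 hi)
  · intro i _ hj hi
    have hj' := fun j => hj j (Nat.zero_le _)
    by_cases h1 : LPO prec (σ.app (ss i)) (σ.app (ts i))
    · refine .head ((hmid i).step_gt (evalCmp_eq_gt.2 h1)) (chain_reaches
        (fun j => LPO prec (σ.app (Term.func f ss)) (σ.app (ts j.succ))) i ?_ ?_ ?_)
      · intro j _ h2
        exact (hleft j).step_gt (evalCmp_eq_gt.2 h2)
      · intro j _ _ h2
        rw [hn.next_ngeq (ord := .lpo prec hprec) (σ := σ)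
          (evalCmp_eq_ngeq.2 ⟨fun h => h2 (LPO.gt_arg h j.succ), fun h => h2 ?_⟩)]
        · exact .single ((hleft j).step_not_gt h2)
        -- Were the two terms equal, the left one would be greater than its own argument.
        · exact LPO.arg_of_ge (.inr h) j.succ
      · intro h2
        rw [hn.next_gt (ord := .lpo prec hprec) (σ := σ)
          (evalCmp_eq_gt.2 (LPO.lex i (fun j h => (hj' j h).2) h1 fun j h => ?_))]
        obtain ⟨j', rfl, hij⟩ := hsucc h
        exact h2 j' hij
    · have hne : σ.app (ss i) ≠ σ.app (ts i) := fun h2 => hi ⟨h1, h2⟩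
      refine .head ((hmid i).step_ngeq (evalCmp_eq_ngeq.2 ⟨h1, hne⟩)) (chain_reaches
        (fun j => ¬ (LPO prec (σ.app (ss j.succ)) (σ.app (Term.func f ts)) ∨
          σ.app (ss j.succ) = σ.app (Term.func f ts))) i ?_ ?_ ?_)
      · intro j _ h2
        exact (hright j).step_not_ge h2
      · intro j _ _ h2
        rw [hn.next_gt (ord := .lpo prec hprec) (σ := σ)
          (evalCmp_eq_gt.2 (LPO.of_arg (not_not.1 h2)))]
        exact .single ((hright j).step_ge (not_not.1 h2))
      · intro h2
        rw [hn.next_ngeq (ord := .lpo prec hprec) (σ := σ)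
          (evalCmp_eq_ngeq.2 ⟨not_lpo_of_last_args hprec (fun j h => (hj' j h).1) h1
          hne fun j h => ?_, fun h => hne (congrFun (args_eq_of_func_eq h) i)⟩)]
        obtain ⟨j', rfl, hij⟩ := hsucc h
        exact h2 j' hij
  · intro hj
    rw [hn.next_of_eq (ord := .lpo prec hprec) (σ := σ)
          (evalCmp_eq_eq.2
      ⟨not_lpo_of_all_args hprec fun j => (hj j (Nat.zero_le _)).1, ?_⟩)]
    rw [Subst.app_func, Subst.app_func]
    congr 1
    exact funext fun j => (hj j (Nat.zero_le _)).2

/-- The second conjunct, that `top` inherits the edges into `n`, lets the retrieval continue at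
`top` along the same path. In the three cases without new comparisons, the missing arguments make
the result the same for all `σ`. -/
theorem LPOReplace.localChange {n top : ℕ} (h : D.PreTOD (.lpo prec hprec))
    (hr : LPOReplace prec D n D' top) :
    LocalChange (.lpo prec hprec) D n D' ∧ ∀ x ℓ, D.Edge x ℓ n → D'.Edge x ℓ top := by
  have key : ∀ {ι : Type} {ν d : ι → ℕ} {K : ℕ}, D.Refines (.lpo prec hprec) n ν d K D' →
      LocalChange (.lpo prec hprec) D n D' ∧ ∀ x ℓ, D.Edge x ℓ n → D'.Edge x ℓ n :=
    fun hR => ⟨hR.localChange h, fun x ℓ hx => hR.edge_keep_self hx (h.ne_of_edge hx)⟩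
  cases hr with
  | greater ν hn hfg hE hν => exact key (refines_lpo_greater hn hfg hE hν)
  | less ν hn hfg hE hν => exact key (refines_lpo_less hn hfg hE hν)
  | same left mid right hn hE hmid hleft hright =>
    exact key (refines_lpo_same hn hE hmid hleft hright)
  | greater_const hn hfg hD =>
    subst hD
    exact ⟨h.localChange_replaceNode hn.adj.1 fun σ =>
      hn.step_gt (evalCmp_eq_gt.2 (LPO.prec hfg nofun)), fun x ℓ => replaceNode_edge_self⟩
  | less_const hn hfg hD =>
    subst hD
    refine ⟨h.localChange_replaceNode hn.adj.2.2 fun σ =>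
      hn.step_ngeq (evalCmp_eq_ngeq.2 ⟨fun h' => ?_, (func_ne_of_prec hprec hfg).symm⟩),
      fun x ℓ => replaceNode_edge_self⟩
    exact (ge_arg_of_lpo_of_prec hprec hfg h').choose.elim0
  | same_const hn hD =>
    subst hD
    refine ⟨h.localChange_replaceNode hn.adj.2.1 fun σ =>
      hn.step_eq (evalCmp_eq_eq.2 ⟨not_lpo_of_all_args hprec nofun, ?_⟩),
      fun x ℓ => replaceNode_edge_self⟩
    rw [Subst.app_func, Subst.app_func]
    congr 1
    exact funext nofun

end LPO

theorem SpecificTransformation.localChange {n top : ℕ} (h : D.PreTOD ord)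
    (hr : D.SpecificTransformation ord n D' top) :
    ∃ D₁, Cleanup D₁ D' ∧ LocalChange ord D n D₁ ∧ ∀ x ℓ, D.Edge x ℓ n → D₁.Edge x ℓ top := by
  cases ord with
  | kbo prec hprec wt =>
    obtain ⟨D₁, hr, hc, rfl⟩ := hr
    obtain ⟨ι, ν, d, K, hR⟩ := hr.exists_refines (hprec := hprec)
    exact ⟨D₁, hc, hR.localChange h, fun x ℓ hx => hR.edge_keep_self hx (h.ne_of_edge hx)⟩
  | lpo prec hprec =>
    obtain ⟨D₁, hr, hc⟩ := hr
    obtain ⟨h1, h2⟩ := hr.localChange h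
    exact ⟨D₁, hc, h1, h2⟩
  | other gt hgt => exact hr.elim

end Specific

end Diagram

/-! ### Invariants of retrievals and insertions. -/

section Retrieval

variable {L : FirstOrder.Language.{u, v}} {V : Type w} {ord : TermOrdering L V}

namespace Diagram

variable {D D' : Diagram L V}

/-- Each node of `S` has at most one incoming edge, and that comes from a node of `S` or
from the root. -/
structure UniquePaths (D : Diagram L V) (S : Finset ℕ) : Prop where
  mem : ∀ n ∈ S, n ∈ D.nodes
  ne_exit : ∀ n ∈ S, n ≠ D.exit
  subsingleton : ∀ n ∈ S, (D.inEdges n).Subsingleton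
  source : ∀ n ∈ S, ∀ m ℓ, D.Edge m ℓ n → m ∈ S ∨ m = D.root

/-- A path into `S` can be traced backwards in only one way: its last edge is determined, the source
of that edge is again in `S` or the root, and nothing enters the root. -/
theorem UniquePaths.path_unique {S : Finset ℕ} (hS : D.UniquePaths S) (h : D.PreTOD ord) {n : ℕ}
    (hn : n ∈ S ∨ n = D.root) {π π' : List (ℕ × Option EdgeLabel)}
    (hπ : D.IsPath D.root π n) (hπ' : D.IsPath D.root π' n) : π = π' := by
  induction π using List.reverseRecOn generalizing n π' with
  | nil =>
    obtain ⟨rfl, -⟩ := isPath_nil_iff.1 hπ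
    exact (h.isPath_to_root hπ').symm
  | append_singleton π p ih =>
    obtain ⟨m, ℓ⟩ := p
    obtain ⟨hm, he⟩ := h.isPath_concat_iff.1 hπ
    have hnr := h.ne_root _ _ _ he
    have hnS := hn.resolve_right hnr
    rcases π'.eq_nil_or_concat' with rfl | ⟨π', ⟨m', ℓ'⟩, rfl⟩
    · exact absurd (isPath_nil_iff.1 hπ').1.symm hnr
    · obtain ⟨hm', he'⟩ := h.isPath_concat_iff.1 hπ'
      have heq : (m, ℓ) = (m', ℓ') := hS.subsingleton n hnS he he'
      cases heq
      rw [ih (hS.source n hnS m ℓ he) hm hm']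

theorem IsTOD.exists_isPath (h : D.IsTOD ord) {n : ℕ} (hn : n ∈ D.nodes) :
    ∃ π, D.IsPath D.root π n := by
  induction h.reachable_root n hn with
  | refl => exact ⟨[], h.preTOD.isPath_root_nil⟩
  | tail _ he ih =>
    obtain ⟨ℓ, he⟩ := he
    obtain ⟨π, hπ⟩ := ih he.1
    exact ⟨_, h.preTOD.isPath_concat_iff.2 ⟨hπ, he⟩⟩

theorem UniquePaths.existsUnique_path {S : Finset ℕ} (hS : D.UniquePaths S) (h : D.IsTOD ord)
    {n : ℕ} (hn : n ∈ S) : ∃! π, D.IsPath D.root π n := by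
  obtain ⟨π, hπ⟩ := h.exists_isPath (hS.mem n hn)
  exact ⟨π, hπ, fun π' hπ' => hS.path_unique h.preTOD (.inl hn) hπ' hπ⟩

/-- This protects the visited nodes: a local change at `n` gives new incoming edges only to new
nodes and to successors of `n`. -/
theorem UniquePaths.not_adj {S : Finset ℕ} (hS : D.UniquePaths S) {n v : ℕ} (hn : n ∉ S)
    (hnr : n ≠ D.root) (hv : v ∈ S) : ¬ D.Adj n v := by
  rintro ⟨ℓ, he⟩
  exact (hS.source v hv n ℓ he).elim hn hnr

theorem UniquePaths.localChange {S : Finset ℕ} (hS : D.UniquePaths S) {n : ℕ} (hn : n ∉ S)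
    (hnr : n ≠ D.root) (hc : LocalChange ord D n D') : D'.UniquePaths S where
  mem v hv := hc.nodes_sub (hS.mem v hv)
  ne_exit v hv := by rw [hc.exit_eq]; exact hS.ne_exit v hv
  subsingleton v hv := (hS.subsingleton v hv).anti fun p hp =>
    hc.edge_of v (hS.mem v hv) (hS.not_adj hn hnr hv) _ _ hp
  source v hv m ℓ he := by
    rw [hc.root_eq]
    exact hS.source v hv m ℓ (hc.edge_of v (hS.mem v hv) (hS.not_adj hn hnr hv) _ _ he)

theorem UniquePaths.trims {S : Finset ℕ} (hS : D.UniquePaths S) (ht : Trims D D') :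
    D'.UniquePaths (S.filter (· ∈ D'.nodes)) where
  mem v hv := (Finset.mem_filter.1 hv).2
  ne_exit v hv := by rw [ht.exit_eq]; exact hS.ne_exit v (Finset.mem_filter.1 hv).1
  subsingleton v hv := (hS.subsingleton v (Finset.mem_filter.1 hv).1).anti fun p hp =>
    (ht.edge_iff.1 hp).1
  source v hv m ℓ he := by
    rw [ht.root_eq]
    exact (hS.source v (Finset.mem_filter.1 hv).1 m ℓ (ht.edge_iff.1 he).1).imp_left
      fun hm => Finset.mem_filter.2 ⟨hm, he.1⟩

theorem LocalChange.isPath {n : ℕ} (hc : LocalChange ord D n D') {a b : ℕ}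
    {π : List (ℕ × Option EdgeLabel)} (hπ : D.IsPath a π b) (hsrc : ∀ p ∈ π, p.1 ≠ n)
    (hb : b ≠ n) : D'.IsPath a π b := by
  induction hπ with
  | nil ha => exact .nil (hc.nodes_sub ha)
  | @cons a c b ℓ π he hπ ih =>
    have hcn : c ≠ n := by
      cases hπ with
      | nil _ => exact hb
      | cons _ _ => exact hsrc _ (.tail _ (.head _))
    exact .cons (hc.edge_keep _ _ _ he (hsrc _ (.head _)) hcn)
      (ih (fun p hp => hsrc p (.tail _ hp)) hb)

theorem LocalChange.equivalent {n : ℕ} {D₁ : Diagram L V} (hc : LocalChange ord D n D₁)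
    (h : D.PreTOD ord) (ht : Trims D₁ D') : D.Equivalent ord D' := by
  have h' := ht.preTOD hc.preTOD
  refine h.equivalent h' fun σ => ?_
  have hr : D'.root = D.root := ht.root_eq.trans hc.root_eq
  rw [hc.collect_eq, ht.collect_eq hc.preTOD σ (hr ▸ h'.root_mem), hr]

end Diagram

namespace Config

open Diagram

variable {F : Diagram L V → List (ℕ × Option EdgeLabel) → ℕ → Option EdgeLabel}
  {σ : Subst L V} {c c' : Config L V}

/-- The invariant of a retrieval. -/
structure Inv (ord : TermOrdering L V) (c : Config L V) : Prop where
  isTOD : c.diag.IsTOD ord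
  unique : c.diag.UniquePaths c.visited
  isPath : c.diag.IsPath c.diag.root c.path c.node
  source : ∀ p ∈ c.path, p.1 ∈ c.visited ∨ p.1 = c.diag.root

theorem Inv.node_mem (h : c.Inv ord) : c.node ∈ c.diag.nodes := h.isPath.mem_right

theorem Inv.ne_root (h : c.Inv ord) (hu : c.Unvisited) : c.node ≠ c.diag.root :=
  hu.2.elim (h.isTOD.preTOD.ne_root_of_isEval h.node_mem)
    (h.isTOD.preTOD.ne_root_of_isSuccess h.node_mem)

theorem Inv.ne_exit (h : c.Inv ord) (hu : c.Unvisited) : c.node ≠ c.diag.exit :=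
  hu.2.elim (h.isTOD.preTOD.ne_exit_of_isEval h.node_mem)
    (h.isTOD.preTOD.ne_exit_of_isSuccess h.node_mem)

theorem Inv.path_eq_concat (h : c.Inv ord) (hu : c.Unvisited) :
    ∃ π m ℓ, c.path = π ++ [(m, ℓ)] ∧ c.diag.Edge m ℓ c.node := by
  have hp := h.isPath
  rcases c.path.eq_nil_or_concat' with hπ | ⟨π, ⟨m, ℓ⟩, hπ⟩
  · rw [hπ] at hp
    exact absurd (isPath_nil_iff.1 hp).1.symm (h.ne_root hu)
  · rw [hπ] at hp
    exact ⟨π, m, ℓ, hπ, (h.isTOD.preTOD.isPath_concat_iff.1 hp).2⟩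

/-- An unvisited node with a single incoming edge may be marked as visited. -/
theorem Inv.unique_insert (h : c.Inv ord) (hu : c.Unvisited)
    (hs : (c.diag.inEdges c.node).Subsingleton) :
    c.diag.UniquePaths (insert c.node c.visited) where
  mem n hn := by
    rcases Finset.mem_insert.1 hn with rfl | hn
    · exact h.node_mem
    · exact h.unique.mem n hn
  ne_exit n hn := by
    rcases Finset.mem_insert.1 hn with rfl | hn
    · exact h.ne_exit hu
    · exact h.unique.ne_exit n hn
  subsingleton n hn := by
    rcases Finset.mem_insert.1 hn with rfl | hn
    · exact hs
    · exact h.unique.subsingleton n hn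
  source n hn m ℓ he := by
    rcases Finset.mem_insert.1 hn with rfl | hn
    · obtain ⟨π, m', ℓ', hπ, he'⟩ := h.path_eq_concat hu
      have heq : (m, ℓ) = (m', ℓ') := hs he he'
      cases heq
      exact (h.source (m, ℓ) (by simp [hπ])).imp_left Finset.mem_insert_of_mem
    · exact (h.unique.source n hn m ℓ he).imp_left Finset.mem_insert_of_mem

/-- The common part of replication, removal and transformation: all three act at the unvisited
current node, and the path followed survives with its last edge now leading to `top`. -/
theorem Inv.change (h : c.Inv ord) (hu : c.Unvisited) {D₁ D' : Diagram L V} {top : ℕ}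
    (hc : LocalChange ord c.diag c.node D₁) (hD : Cleanup D₁ D')
    {π : List (ℕ × Option EdgeLabel)} {m : ℕ} {ℓ : Option EdgeLabel}
    (hπ : c.path = π ++ [(m, ℓ)]) (he : D₁.Edge m ℓ top) :
    (c.change D' top).Inv ord ∧ c.diag.Equivalent ord D' := by
  have ht := hD.trims
  -- The path starts its edges at visited nodes or the root only, and the current node is neither.
  have hsrc : ∀ p ∈ c.path, p.1 ≠ c.node := by
    intro p hp hpn
    rcases h.source p hp with h' | h'
    · exact hu.1 (hpn ▸ h')
    · exact h.ne_root hu (hpn ▸ h')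
  have hp := h.isPath
  rw [hπ, h.isTOD.preTOD.isPath_concat_iff] at hp
  have hroot : D'.root = c.diag.root := ht.root_eq.trans hc.root_eq
  have hD' := hD.isTOD hc.preTOD
  have hpath : D'.IsPath D'.root c.path top := by
    refine ht.isPath hc.preTOD ?_ hD'.root_mem
    rw [hroot, hπ, hc.preTOD.isPath_concat_iff]
    exact ⟨hc.isPath hp.1 (fun p hp => hsrc p (by simp [hπ, hp])) (hsrc (m, ℓ) (by simp [hπ])), he⟩
  refine ⟨⟨hD', (h.unique.localChange hu.1 (h.ne_root hu) hc).trims ht, hpath, fun p hp => ?_⟩,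
    hc.equivalent h.isTOD.preTOD ht⟩
  -- The cleanup cannot have removed nodes on the path, since it is still a path from the root in
  -- `D'`.
  have hmem : p.1 ∈ D'.nodes := by
    obtain ⟨_, _, _, -, -, he, -⟩ := hpath.exists_split hp
    exact he.1
  refine (h.source p hp).imp (fun h' => Finset.mem_filter.2 ⟨h', hmem⟩) fun h' => ?_
  exact h'.trans hroot.symm

/-- Every traversal through the current node, for any substitution, must begin with the path
followed, as there is no other path to that node. The edge it takes next is then the one prescribed
by `F`. -/
theorem Inv.forces (hF : IsForcingFunction ord F) (h : c.Inv ord) (hu : c.Unvisited)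
    (hs : (c.diag.inEdges c.node).Subsingleton) (he : (c.diag.label c.node).IsEval)
    {ℓ : EdgeLabel} (hℓ : F c.diag c.path c.node = some ℓ) : c.diag.Forces ord c.node ℓ := by
  refine ⟨he, fun σ' π' hπ' hmem => ?_⟩
  obtain ⟨p, hp, hpn⟩ := hmem
  obtain ⟨π₁, π₂, d, rfl, h₁, hedge, -⟩ := hπ'.1.exists_split hp
  have hpe := hπ'.2 p hp
  obtain ⟨n, k⟩ := p
  simp only at hpn h₁ hedge hpe
  subst hpn
  -- The node is unvisited, but having a single incoming edge it can be added to the visited set for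
  -- the sake of the uniqueness argument.
  have huniq := (h.unique_insert hu hs).path_unique h.isTOD.preTOD
    (.inl (Finset.mem_insert_self _ _)) h₁ h.isPath
  subst huniq
  rw [← hpe he]
  refine hF _ h.isTOD σ' _ _ _ k ℓ h₁ hedge (fun q hq => hπ'.2 q ?_) hℓ
  rcases List.mem_append.1 hq with hq | hq
  · exact List.mem_append_left _ hq
  · rw [List.mem_singleton.1 hq]
    exact hp

theorem StepRemove.redundant (hF : IsForcingFunction ord F) (h : c.Inv ord)
    (hs : StepRemove F c c') : ∃ m ℓ' ℓ n₂, F c.diag c.path c.node = some ℓ ∧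
      c.diag.RedundantNodeRemoval ord m ℓ' c.node ℓ n₂ c'.diag := by
  obtain ⟨hu, hsub, π, m, ℓ', ℓ, n₂, D', hπ, hℓ, hb, rfl⟩ := hs
  exact ⟨m, ℓ', ℓ, n₂, hℓ, h.forces hF hu hsub hb.2.1 hℓ, hb⟩

theorem Step.transformation (hF : IsForcingFunction ord F) (h : c.Inv ord)
    (hs : Step ord F σ c c') : c'.diag = c.diag ∨ c.diag.Transformation ord c'.diag := by
  cases hs with
  | success hs => obtain ⟨-, -, rfl⟩ := hs; exact .inl rfl
  | follow hs => obtain ⟨-, -, rfl⟩ := hs; exact .inl rfl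
  | mark hs => obtain ⟨-, -, -, -, rfl⟩ := hs; exact .inl rfl
  | replicate hs =>
    obtain ⟨-, -, π, m, ℓ, n₂, D', -, hr, rfl⟩ := hs
    exact .inr (.replication m ℓ c.node n₂ hr)
  | remove hs =>
    obtain ⟨m, ℓ', ℓ, n₂, -, hr⟩ := hs.redundant hF h
    exact .inr (.redundant m ℓ' c.node ℓ n₂ hr)
  | transform hs =>
    obtain ⟨-, -, D', top, hr, rfl⟩ := hs
    exact .inr (.specific c.node top hr)

theorem Inv.follow (h : c.Inv ord) (hn : c.node ∈ c.visited) {ℓ : Option EdgeLabel} {n : ℕ}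
    (he : c.diag.Edge c.node ℓ n) :
    Inv ord { c with path := c.path ++ [(c.node, ℓ)], node := n } where
  isTOD := h.isTOD
  unique := h.unique
  isPath := h.isTOD.preTOD.isPath_concat_iff.2 ⟨h.isPath, he⟩
  source p hp := by
    rcases List.mem_append.1 hp with hp | hp
    · exact h.source p hp
    · rw [List.mem_singleton.1 hp]
      exact .inl hn

theorem Inv.step (hF : IsForcingFunction ord F) (h : c.Inv ord) (hs : Step ord F σ c c') :
    c'.Inv ord ∧ c.diag.Equivalent ord c'.diag := by
  have hpre := h.isTOD.preTOD
  cases hs with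
  | success hs =>
    obtain ⟨hn, hl, rfl⟩ := hs
    refine ⟨h.follow hn ⟨h.node_mem, ?_, rfl⟩, fun _ => rfl⟩
    cases hc : c.diag.label c.node <;> rw [hc] at hl <;> first | exact hl.elim | rfl
  | follow hs =>
    obtain ⟨hn, hl, rfl⟩ := hs
    exact ⟨h.follow hn (hpre.edge_eval σ h.node_mem (hpre.ne_exit_of_isEval h.node_mem hl)),
      fun _ => rfl⟩
  | mark hs =>
    obtain ⟨hu, hsub, -, -, rfl⟩ := hs
    exact ⟨⟨h.isTOD, h.unique_insert hu hsub, h.isPath,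
      fun p hp => (h.source p hp).imp_left Finset.mem_insert_of_mem⟩, fun _ => rfl⟩
  | replicate hs =>
    obtain ⟨hu, hin, π, m, ℓ, n₂, D', hπ, ⟨he, hx, -, hn₂, hD'⟩, rfl⟩ := hs
    replace hD' : D' = c.diag.replicate m ℓ c.node n₂ := hD'
    subst hD'
    have hc := hpre.localChange_replicate he hx hn₂
    have hT := hc.preTOD.isTOD (noOrphan_replicate h.isTOD.noOrphan he hn₂ hin)
    exact h.change hu hc hT.cleanup_self hπ (replicate_edge_self hn₂ he)
  | remove hs =>
    obtain ⟨hu, hsub, π, m, ℓ', ℓ, n₂, D', hπ, hℓ, ⟨he, hl, hn, hD⟩, rfl⟩ := hs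
    refine h.change hu (hpre.localChange_redirect he hn (h.forces hF hu hsub hl hℓ)) hD hπ ?_
    exact redirect_edge_iff.2 (.inl ⟨rfl, rfl, rfl, he.1, he.2.1, rfl⟩)
  | transform hs =>
    obtain ⟨hu, hsub, D', top, hr, rfl⟩ := hs
    obtain ⟨D₁, hD, hc, htop⟩ := hr.localChange hpre
    obtain ⟨π, m, ℓ, hπ, he⟩ := h.path_eq_concat hu
    exact h.change hu hc hD hπ (htop m ℓ he)

end Config

namespace Index

open Diagram

variable {F : Diagram L V → List (ℕ × Option EdgeLabel) → ℕ → Option EdgeLabel}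
  {σ : Subst L V} {I I' : Index L V}

/-- The invariant of an index. -/
structure Inv (ord : TermOrdering L V) (I : Index L V) : Prop where
  isTOD : I.diag.IsTOD ord
  unique : I.diag.UniquePaths I.visited

theorem Inv.start (h : I.Inv ord) : I.start.Inv ord where
  isTOD := h.isTOD
  unique := h.unique
  isPath := by
    have he : I.diag.Edge I.diag.root none (I.diag.next I.diag.root none) :=
      ⟨h.isTOD.root_mem, by rw [(h.isTOD.label_root _ h.isTOD.root_mem).2 rfl]; rfl, rfl⟩
    exact .cons he (.nil (h.isTOD.target_mem _ _ _ he))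
  source p hp := by
    rw [List.mem_singleton.1 hp]
    exact .inr rfl

theorem Inv.reaches (hF : IsForcingFunction ord F) (h : I.Inv ord) {c : Config L V}
    (hc : Reaches ord F σ I c) : c.Inv ord ∧ I.diag.Equivalent ord c.diag := by
  induction hc with
  | refl => exact ⟨h.start, fun _ => rfl⟩
  | tail _ hs ih =>
    obtain ⟨h1, h2⟩ := ih.1.step hF hs
    exact ⟨h1, fun τ => (ih.2 τ).trans (h2 τ)⟩

theorem Inv.retrieval (hF : IsForcingFunction ord F) (h : I.Inv ord)
    (hr : Retrieval ord F σ I I') : I'.Inv ord ∧ I.diag.Equivalent ord I'.diag := by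
  obtain ⟨c, hc, -, rfl⟩ := hr
  obtain ⟨h1, h2⟩ := h.reaches hF hc
  exact ⟨⟨h1.isTOD, h1.unique⟩, h2⟩

/-- Old nodes other than the exit keep their incoming edges. As visited nodes differ from the exit
(`ne_exit`), the tree of visited nodes is untouched. -/
theorem Inv.insertion (h : I.Inv ord) {l r : L.Term V} (hi : Insertion l r I I') :
    I'.Inv ord := by
  obtain ⟨a, b, ha, hb, hab, rfl⟩ := hi
  obtain ⟨D, S⟩ := I
  obtain ⟨hT, hS⟩ := h
  simp only at ha hb hT hS ⊢
  have hpre := hT.preTOD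
  set D' : Diagram L V :=
    { D with
      nodes := insert a (insert b D.nodes)
      label := fun x => if x = a then .cmp l r else if x = b then .success l r else D.label x
      next := fun x y =>
        if x = a then (if y = some .gt then b else D.exit)
        else if x = b then D.exit
        else if D.next x y = D.exit then a
        else D.next x y } with hD'
  have hne : ∀ x ∈ D.nodes, x ≠ a ∧ x ≠ b := by
    rintro x hx
    exact ⟨fun h => ha (h ▸ hx), fun h => hb (h ▸ hx)⟩
  have hmem : ∀ x, x ∈ D'.nodes ↔ x = a ∨ x = b ∨ x ∈ D.nodes := by
    intro x; simp [hD']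
  have hla : D'.label a = .cmp l r := if_pos rfl
  have hlb : D'.label b = .success l r := by simp [hD', hab.symm]
  have hl : ∀ x ∈ D.nodes, D'.label x = D.label x := by
    intro x hx; simp [hD', (hne x hx).1, (hne x hx).2]
  have hedge : ∀ x k y, D'.Edge x k y → (x = a ∧ (y = b ∨ y = D.exit)) ∨ (x = b ∧ y = D.exit) ∨
      (D.Edge x k D.exit ∧ y = a) ∨ (y ≠ D.exit ∧ D.Edge x k y) := by
    rintro x k y ⟨hx, hk, rfl⟩
    rcases (hmem x).1 hx with rfl | rfl | hx
    · refine .inl ⟨rfl, ?_⟩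
      by_cases hk : k = some .gt <;> simp [hD', hk]
    · exact .inr (.inl ⟨rfl, by simp [hD', hab.symm]⟩)
    · rw [hl x hx] at hk
      by_cases hn : D.next x k = D.exit
      · exact .inr (.inr (.inl ⟨⟨hx, hk, hn⟩, by simp [hD', hne x hx, hn]⟩))
      · have hn' : D'.next x k = D.next x k := by simp [hD', hne x hx, hn]
        rw [hn']
        exact .inr (.inr (.inr ⟨hn, hx, hk, rfl⟩))
  have hkeep : ∀ x k y, D.Edge x k y → y ≠ D.exit → D'.Edge x k y := by
    rintro x k y ⟨hx, hk, rfl⟩ hy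
    exact ⟨(hmem x).2 (.inr (.inr hx)), by rwa [hl x hx], by simp [hD', hne x hx, hy]⟩
  have hkeepx : ∀ x k, D.Edge x k D.exit → D'.Edge x k a := by
    rintro x k ⟨hx, hk, hy⟩
    exact ⟨(hmem x).2 (.inr (.inr hx)), by rwa [hl x hx], by simp [hD', hne x hx, hy]⟩
  have hxr : D.exit ≠ D.root := by
    intro h'
    have h1 := (hT.label_exit _ hT.exit_mem).2 rfl
    rw [(hT.label_root _ hT.exit_mem).2 h'] at h1
    cases h1
  have hpre' : D'.PreTOD ord := by
    refine ⟨(hmem _).2 (.inr (.inr hT.root_mem)), ?_, ?_, ?_, ?_, ?_, ?_⟩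
    · intro x hx
      rcases (hmem x).1 hx with rfl | rfl | hx
      · rw [hla]
        exact iff_of_false nofun (hne _ hT.root_mem).1.symm
      · rw [hlb]
        exact iff_of_false nofun (hne _ hT.root_mem).2.symm
      · rw [hl x hx]
        exact hT.label_root x hx
    · intro x hx
      rcases (hmem x).1 hx with rfl | rfl | hx
      · rw [hla]
        exact iff_of_false nofun (hne _ hT.exit_mem).1.symm
      · rw [hlb]
        exact iff_of_false nofun (hne _ hT.exit_mem).2.symm
      · rw [hl x hx]
        exact hT.label_exit x hx
    · intro x k y hxy
      rw [hmem]
      rcases hedge x k y hxy with ⟨-, rfl | rfl⟩ | ⟨-, rfl⟩ | ⟨-, rfl⟩ | ⟨-, h'⟩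
      · exact .inr (.inl rfl)
      · exact .inr (.inr hT.exit_mem)
      · exact .inr (.inr hT.exit_mem)
      · exact .inl rfl
      · exact .inr (.inr (hT.target_mem _ _ _ h'))
    · intro x k y hxy
      change y ≠ D.root
      rcases hedge x k y hxy with ⟨-, rfl | rfl⟩ | ⟨-, rfl⟩ | ⟨-, rfl⟩ | ⟨-, h'⟩
      · exact (hne _ hT.root_mem).2.symm
      · exact hxr
      · exact hxr
      · exact (hne _ hT.root_mem).1.symm
      · exact hpre.ne_root _ _ _ h'
    · obtain ⟨ρ, hρ⟩ := hpre.exists_rank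
      -- The exit gets rank `0`, the success node `1` and the comparison node `2`; adding `3` lifts
      -- all other nodes above these.
      refine ⟨fun x => if x = a then 2 else if x = b then 1 else if x = D.exit then 0 else ρ x + 3,
        fun x k y hxy => ?_⟩
      have hxa := hne _ hT.exit_mem
      dsimp only
      rcases hedge x k y hxy with ⟨rfl, rfl | rfl⟩ | ⟨rfl, rfl⟩ | ⟨h', rfl⟩ | ⟨hy, h'⟩
      · simp [hab.symm]
      · simp [hxa]
      · simp [hxa, hab.symm]
      · have := hne _ h'.1
        simp [this, hpre.ne_exit_of_edge h']
      · have h1 := hne _ h'.1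
        have h2 := hne _ (hT.target_mem _ _ _ h')
        simpa [h1, h2, hy, hpre.ne_exit_of_edge h'] using hρ _ _ _ h'
    · intro x hx e he
      rcases (hmem x).1 hx with rfl | rfl | hx
      · rw [hla] at he
        cases he
      · rw [hlb] at he
        cases he
      · rw [hl x hx] at he
        exact hT.pos_kbo x hx e he
  have hna : ∀ v ∈ S, v ≠ a ∧ v ≠ b := fun v hv => hne v (hS.mem v hv)
  have hback : ∀ v ∈ S, ∀ x k, D'.Edge x k v → D.Edge x k v := by
    intro v hv x k hxy
    rcases hedge x k v hxy with ⟨-, h' | h'⟩ | ⟨-, h'⟩ | ⟨-, h'⟩ | ⟨-, h'⟩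
    · exact absurd h' (hna v hv).2
    · exact absurd h' (hS.ne_exit v hv)
    · exact absurd h' (hS.ne_exit v hv)
    · exact absurd h' (hna v hv).1
    · exact h'
  refine ⟨hpre'.isTOD fun x hx hxr' => ?_, ?_, ?_, ?_, ?_⟩
  -- The node `a` inherits the incoming edges of the exit, `b` is entered from `a`, and the exit
  -- from `b`.
  · rcases (hmem x).1 hx with rfl | rfl | hx
    · obtain ⟨⟨m, k⟩, he⟩ := hT.noOrphan _ hT.exit_mem hxr
      exact ⟨(m, k), hkeepx m k he⟩
    · refine ⟨(a, some .gt), (hmem a).2 (.inl rfl), ?_, ?_⟩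
      · rw [hla]
        exact .inl rfl
      · simp [hD']
    · by_cases hxe : x = D.exit
      · subst hxe
        refine ⟨(b, none), (hmem b).2 (.inr (.inl rfl)), ?_, ?_⟩
        · rw [hlb]
          rfl
        · simp [hD', hab.symm]
      · obtain ⟨⟨m, k⟩, he⟩ := hT.noOrphan x hx hxr'
        exact ⟨(m, k), hkeep m k x he hxe⟩
  · exact fun v hv => (hmem v).2 (.inr (.inr (hS.mem v hv)))
  · exact hS.ne_exit
  · exact fun v hv => (hS.subsingleton v hv).anti fun p hp => hback v hv _ _ hp
  · exact fun v hv m k he => hS.source v hv m k (hback v hv m k he)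

theorem Arises.inv (hF : IsForcingFunction ord F) (h : Arises ord F I) : I.Inv ord := by
  induction h with
  | init D hD => exact ⟨hD, ⟨nofun, nofun, nofun, nofun⟩⟩
  | insertion l r _ hi ih => exact ih.insertion hi
  | retrieval σ _ hr ih => exact (ih.retrieval hF hr).1

end Index

end Retrieval

end TOD

theorem mainTheorem3 {L : FirstOrder.Language.{u, v}} {V : Type w} (ord : TOD.TermOrdering L V)
    (F : TOD.Diagram L V → List (ℕ × Option TOD.EdgeLabel) → ℕ → Option TOD.EdgeLabel)
    (hF : TOD.IsForcingFunction ord F)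
    (I : TOD.Index L V) (hI : TOD.Index.Arises ord F I) (σ : TOD.Subst L V) :
    -- the TOD produced by a retrieval is equivalent to the one before the retrieval
    (∀ I' : TOD.Index L V, TOD.Index.Retrieval ord F σ I I' →
      I'.diag.IsTOD ord ∧ I.diag.Equivalent ord I'.diag) ∧
    -- moreover, at every point of the retrieval:
    (∀ c : TOD.Config L V, TOD.Index.Reaches ord F σ I c →
      c.diag.IsTOD ord ∧ I.diag.Equivalent ord c.diag ∧
      -- a visited node has a unique root path
      (∀ n ∈ c.visited, ∃! π, c.diag.IsPath c.diag.root π n) ∧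
      -- a step applied because `F` gives a label is a redundant node removal at the current node
      (∀ c' : TOD.Config L V, TOD.Config.StepRemove F c c' →
        ∃ m ℓ' ℓ n₂, F c.diag c.path c.node = some ℓ ∧
          c.diag.RedundantNodeRemoval ord m ℓ' c.node ℓ n₂ c'.diag) ∧
      -- every step leaves the TOD unchanged or is a TOD transformation
      (∀ c' : TOD.Config L V, TOD.Config.Step ord F σ c c' →
        c'.diag = c.diag ∨ c.diag.Transformation ord c'.diag)) := by
  have hI' := hI.inv hF
  refine ⟨fun I' hr => ?_, fun c hc => ?_⟩
  · obtain ⟨h1, h2⟩ := hI'.retrieval hF hr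
    exact ⟨h1.isTOD, h2⟩
  · obtain ⟨h1, h2⟩ := hI'.reaches hF hc
    exact ⟨h1.isTOD, h2, fun n hn => h1.unique.existsUnique_path h1.isTOD hn,
      fun c' hs => hs.redundant hF h1, fun c' hs => hs.transformation hF h1⟩
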